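/- Let $0<t_0\le t\le t_1$, let $h_1,h_2>1$ and $\eta_2,\theta_2,\theta_3>0$. Define \[ K:=\left\lceil\frac{\frac{3}{34}\log t-\log(\theta_2\sqrt{2\pi})}{\log h_1}\right\rceil,\qquad a_K:=\left\lfloor h_1^{-K}\sqrt{\tfrac{t}{2\pi}}\right\rfloor, \] \[ R(x):=\left\lceil\frac{\frac{115}{1394}\log x-\log(\theta_3/\theta_2)}{\log h_2}\right\rceil\ (x>0),\qquad a'_R:=\left\lfloor h_2^{-R(t)}\theta_2t^{7/17}\right\rfloor, \] so that $a'_R\le\theta_3t^{27/82}$ and $a_K\le\theta_2t^{7/17}$, and let \[ S_2:=\sum_{a'_R<n\le a_K}n^{-1/2-it} \] (an empty sum being $0$). Assume that $\frac{h_2}{\theta_3}t_0^{-27/82}<1$ and $R(t_1)\ge 0$. Then \[ |S_2|\le D_3\,t^{19/119}+D_4\,t^{71/476}, \] where \[ h_3:=\frac{h_2}{1-\frac{h_2}{\theta_3}t_0^{-27/82}}, \] \[ D_3:=\frac{3^{1/14}}{\pi^{1/14}}A_4(\eta_2,h_3)\,h_3^{5/7}(h_3-1)\,\theta_2^{3/14}\,\frac{1-h_2^{-3R(t_1)/14}}{h_2^{3/14}-1},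 \] \[ D_4:=\frac{\pi^{1/14}}{3^{1/14}}B_4(\eta_2)\,h_3^{2/7}(h_3-1)^{3/4}\,\theta_2^{15/28}\,\frac{1-h_2^{-15R(t_1)/28}}{h_2^{15/28}-1}. \] Here, for $\eta>0$ and $h>1$, \[ A_3(\eta,h):=\delta\sqrt{\frac1{\eta h}+\frac{32}{15\sqrt\pi}\sqrt{\eta+\lambda_0^{1/3}}+\frac13\left(\eta+\lambda_0^{1/3}\right)\lambda_0^{1/3}},\qquad B_3(\eta):=\frac{\sqrt{32}}{\sqrt3\,\pi^{1/4}\eta^{1/4}}\,\delta, \] \[ \lambda_0:=\left(\frac1\eta+\frac{32\eta^{1/2}h}{15\sqrt\pi}\right)^{-3},\qquad \delta:=\sqrt{\frac12+\frac12\sqrt{1+\frac38\pi^{1/2}\eta^{3/2}}}, \] and $A_4,B_4$ are obtained by taking $k=3$ in the recursion, in which $Q:=2^{k-1}$, \[ A_{k+1}(\eta,h):=\delta_k\left(h^{-1/Q}+\frac{2^{19/12}(Q-1)}{\sqrt{(2Q-1)(4Q-3)}}A_k(\eta,h)^{1/2}\right),\qquad B_{k+1}(\eta):=\delta_k\frac{2^{3/2}(Q-1)}{\sqrt{(2Q-3)(4Q-5)}}B_k(\eta)^{1/2},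 \] \[ \delta_k:=\sqrt{1+\frac{2}{2337^{1-2/Q}}\left(\frac{9\pi}{1024}\eta\right)^{1/Q}}. \] -/

import Mathlib

noncomputable section

namespace SubWeyl

/-- The base quantity `λ₀` of the third derivative test. -/
def lambdaZero (η h : ℝ) : ℝ :=
  (1 / η + 32 * η ^ ((1 : ℝ) / 2) * h / (15 * √Real.pi)) ^ (-3 : ℤ)

/-- The factor `δ₃` occurring in `A₃` and `B₃`. -/
def deltaBase (η : ℝ) : ℝ :=
  √(1 / 2 + 1 / 2 * √(1 + 3 / 8 * Real.pi ^ ((1 : ℝ) / 2) * η ^ ((3 : ℝ) / 2)))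

/-- `A₃(η, h)` of the third derivative test. -/
def A₃ (η h : ℝ) : ℝ :=
  √(1 / (η * h)
      + 32 / (15 * √Real.pi) * √(η + lambdaZero η h ^ ((1 : ℝ) / 3))
      + 1 / 3 * (η + lambdaZero η h ^ ((1 : ℝ) / 3)) * lambdaZero η h ^ ((1 : ℝ) / 3))
    * deltaBase η

/-- `B₃(η)` of the third derivative test. -/
def B₃ (η : ℝ) : ℝ :=
  √32 / (√3 * Real.pi ^ ((1 : ℝ) / 4) * η ^ ((1 : ℝ) / 4)) * deltaBase η

/-- `K = 2 ^ (k - 1)`, as a real number. -/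
def bigK (k : ℕ) : ℝ := 2 ^ (k - 1)

/-- The factor `δ_k` occurring in the recursion from `A_k`, `B_k` to `A_{k+1}`, `B_{k+1}`. -/
def deltaStep (k : ℕ) (η : ℝ) : ℝ :=
  √(1 + 2 / (2337 : ℝ) ^ (1 - 2 / bigK k) * (9 * Real.pi / 1024 * η) ^ (1 / bigK k))

/-- The constants `A_k(η, h)` of the `k`-th derivative test, `k ≥ 3` (value `0` for `k < 3`). -/
def derivA : ℕ → ℝ → ℝ → ℝ
  | 0, _, _ => 0
  | 1, _, _ => 0
  | 2, _, _ => 0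
  | 3, η, h => A₃ η h
  | k + 4, η, h =>
      deltaStep (k + 3) η *
        (h ^ (-(1 / bigK (k + 3)))
          + (2 : ℝ) ^ ((19 : ℝ) / 12) * (bigK (k + 3) - 1)
              / √((2 * bigK (k + 3) - 1) * (4 * bigK (k + 3) - 3))
            * derivA (k + 3) η h ^ ((1 : ℝ) / 2))

/-- The constants `B_k(η)` of the `k`-th derivative test, `k ≥ 3` (value `0` for `k < 3`). -/
def derivB : ℕ → ℝ → ℝ
  | 0, _ => 0
  | 1, _ => 0
  | 2, _ => 0
  | 3, η => B₃ η
  | k + 4, η =>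
      deltaStep (k + 3) η *
        ((2 : ℝ) ^ ((3 : ℝ) / 2) * (bigK (k + 3) - 1)
            / √((2 * bigK (k + 3) - 3) * (4 * bigK (k + 3) - 5)))
        * derivB (k + 3) η ^ ((1 : ℝ) / 2)

/-- `K(t)`, the index of the last of the upper cut points `a_k`. -/
def K (h₁ θ₂ t : ℝ) : ℤ :=
  ⌈(3 / 34 * Real.log t - Real.log (θ₂ * √(2 * Real.pi))) / Real.log h₁⌉

/-- `a_k = ⌊h₁ ^ (-k) √(t / 2π)⌋`. -/
def a (h₁ t : ℝ) (k : ℤ) : ℕ := ⌊h₁ ^ (-k) * √(t / (2 * Real.pi))⌋₊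

/-- `R(t)`, the index of the last of the lower cut points `a'_r`. -/
def R (h₂ θ₂ θ₃ t : ℝ) : ℤ :=
  ⌈(115 / 1394 * Real.log t - Real.log (θ₃ / θ₂)) / Real.log h₂⌉

/-- `a'_r = ⌊h₂ ^ (-r) θ₂ t ^ (7/17)⌋`. -/
def a' (h₂ θ₂ t : ℝ) (r : ℤ) : ℕ := ⌊h₂ ^ (-r) * θ₂ * t ^ ((7 : ℝ) / 17)⌋₊

/-- The middle sum `S₂ = ∑_{a'_R < n ≤ a_K} n ^ (-1/2 - it)`. -/
def S₂ (h₁ h₂ θ₂ θ₃ t : ℝ) : ℂ :=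
  ∑ n ∈ Finset.Ioc (a' h₂ θ₂ t (R h₂ θ₂ θ₃ t)) (a h₁ t (K h₁ θ₂ t)),
    (n : ℂ) ^ (-(1 / 2 : ℂ) - Complex.I * (t : ℂ))

/-- The ratio bound `h₃` for consecutive cut points. -/
def h₃ (h₂ θ₃ t₀ : ℝ) : ℝ :=
  h₂ / (1 - h₂ / θ₃ * t₀ ^ (-(27 : ℝ) / 82))

/-- The constant `D₃`. -/
def D₃ (t₀ t₁ h₂ η₂ θ₂ θ₃ : ℝ) : ℝ :=
  (3 : ℝ) ^ ((1 : ℝ) / 14) / Real.pi ^ ((1 : ℝ) / 14)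
    * derivA 4 η₂ (h₃ h₂ θ₃ t₀)
    * h₃ h₂ θ₃ t₀ ^ ((5 : ℝ) / 7) * (h₃ h₂ θ₃ t₀ - 1) * θ₂ ^ ((3 : ℝ) / 14)
    * ((1 - h₂ ^ (-(3 * (R h₂ θ₂ θ₃ t₁ : ℝ)) / 14)) / (h₂ ^ ((3 : ℝ) / 14) - 1))

/-- The constant `D₄`. -/
def D₄ (t₀ t₁ h₂ η₂ θ₂ θ₃ : ℝ) : ℝ :=
  Real.pi ^ ((1 : ℝ) / 14) / (3 : ℝ) ^ ((1 : ℝ) / 14)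
    * derivB 4 η₂
    * h₃ h₂ θ₃ t₀ ^ ((2 : ℝ) / 7) * (h₃ h₂ θ₃ t₀ - 1) ^ ((3 : ℝ) / 4) * θ₂ ^ ((15 : ℝ) / 28)
    * ((1 - h₂ ^ (-(15 * (R h₂ θ₂ θ₃ t₁ : ℝ)) / 28)) / (h₂ ^ ((15 : ℝ) / 28) - 1))

end SubWeyl

end

noncomputable section

namespace SubWeyl

open Finset

/-! With e(x) = exp(2πix), the summand is n^(-1/2) e(-(t/2π) log n). The points a'_r cut the range
into R(t) blocks, truncated above at a_K ≤ a'_0, and consecutive cut points have ratio at most h₃.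
On a block starting at a, a fourth derivative test bounds the unweighted sum and Abel summation
restores the weight (`norm_sum_Ioc_cpow_le`). This gives constants times t^(1/14) a^(3/14) and
t^(-1/14) a^(15/28). Inserting a ≤ h₂^(-r) θ₂ t^(7/17) produces the exponents 19/119 and 71/476 and
two geometric series in r, whose sums are the last factors of D₃ and D₄.

The derivative tests are proved for real sequences, with forward differences in place of
derivatives. The Kusmin–Landau inequality controls a sum whose first differences increase and stay
away from integers. Trivial estimates near the integers complete it to a second derivative test.
Weyl–van der Corput differencing replaces f by f(n+r) - f(n), whose (k-1)-th differences are sums of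
r k-th differences of f, so that λ becomes rλ. Two such steps lead to the third test (step number Q
about ηλ^(-1/3)) and the fourth (Q about λ^(-1/7)).

The factors δ absorb the ratio (N+Q-1)/N lost in differencing. If N is small or λ is large, the
claimed bound already exceeds the trivial bound N; otherwise Q/N is small enough for that ratio to
be at most δ². -/

/-- The additive character `x ↦ exp (2πix)`. -/
def expChar (x : ℝ) : ℂ := Complex.exp (2 * Real.pi * x * Complex.I)

/-! ### Elementary properties of the additive character. -/

lemma norm_expChar (x : ℝ) : ‖expChar x‖ = 1 := by
  have := Complex.norm_exp_ofReal_mul_I (2 * Real.pi * x)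
  simpa [expChar] using this

lemma expChar_add (x y : ℝ) : expChar (x + y) = expChar x * expChar y := by
  rw [expChar, expChar, expChar, ← Complex.exp_add]
  congr 1
  push_cast
  ring

lemma expChar_intCast (m : ℤ) : expChar m = 1 := by
  rw [expChar, Complex.exp_eq_one_iff]
  exact ⟨m, by push_cast; ring⟩

lemma conj_expChar (x : ℝ) : (starRingEnd ℂ) (expChar x) = expChar (-x) := by
  rw [expChar, expChar, ← Complex.exp_conj]
  congr 1
  simp only [map_mul, Complex.conj_ofReal, Complex.conj_I, Complex.conj_ofNat]
  push_cast
  ring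

lemma expChar_eq_cos_add_sin (x : ℝ) :
    expChar x = (Real.cos (2 * (Real.pi * x)) : ℂ) + (Real.sin (2 * (Real.pi * x)) : ℂ) * Complex.I := by
  rw [expChar, Complex.ofReal_cos, Complex.ofReal_sin, ← Complex.exp_mul_I]
  congr 1
  push_cast
  ring

lemma norm_sum_expChar_le_card (f : ℕ → ℝ) (s : Finset ℕ) :
    ‖∑ n ∈ s, expChar (f n)‖ ≤ s.card := by
  refine (norm_sum_le _ _).trans ?_
  simp [norm_expChar]

/-! ### The Kusmin–Landau inequality. -/

/-- `1 / (1 - exp (2iα))`, in terms of the cotangent. -/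
def halfCot (α : ℝ) : ℂ := (1 + (Real.cos α / Real.sin α : ℝ) * Complex.I) / 2

lemma one_sub_expChar_mul_halfCot {x : ℝ} (h : Real.sin (Real.pi * x) ≠ 0) :
    (1 - expChar x) * halfCot (Real.pi * x) = 1 := by
  rw [expChar_eq_cos_add_sin, halfCot, Real.cos_two_mul, Real.sin_two_mul]
  have hs := Real.sin_sq_add_cos_sq (Real.pi * x)
  have hq : Real.cos (Real.pi * x) / Real.sin (Real.pi * x) * Real.sin (Real.pi * x)
      = Real.cos (Real.pi * x) := div_mul_cancel₀ _ h
  generalize Real.cos (Real.pi * x) / Real.sin (Real.pi * x) = q at hq ⊢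
  generalize Real.sin (Real.pi * x) = s at hs hq ⊢
  rw [← hq] at hs ⊢
  have hs' : (s : ℂ) ^ 2 + ((q : ℂ) * s) ^ 2 = 1 := by exact_mod_cast hs
  push_cast
  linear_combination (-(q : ℂ) * Complex.I) * hs'
    - (q : ℂ) ^ 2 * s ^ 2 * Complex.I_sq

lemma norm_halfCot {α : ℝ} (h : 0 < Real.sin α) : ‖halfCot α‖ = 1 / (2 * Real.sin α) := by
  have hs := Real.sin_sq_add_cos_sq α
  have hq : Real.cos α / Real.sin α * Real.sin α = Real.cos α := div_mul_cancel₀ _ h.ne'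
  have h1 : ‖halfCot α‖ ^ 2 = (1 / (2 * Real.sin α)) ^ 2 := by
    rw [halfCot, ← Complex.normSq_eq_norm_sq, map_div₀, ← mul_one (1 : ℂ),
      ← Complex.ofReal_one, ← Complex.ofReal_mul, Complex.normSq_add_mul_I]
    generalize Real.cos α / Real.sin α = q at hq ⊢
    rw [← hq] at hs
    rw [Complex.normSq_ofNat]
    field_simp
    linear_combination hs
  exact (sq_eq_sq₀ (norm_nonneg _) (by positivity)).1 h1

lemma cot_le_cot {x y : ℝ} (hx : 0 < x) (hxy : x ≤ y) (hy : y < Real.pi) :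
    Real.cos y / Real.sin y ≤ Real.cos x / Real.sin x := by
  have h1 : 0 < Real.sin x := Real.sin_pos_of_pos_of_lt_pi hx (by linarith)
  have h2 : 0 < Real.sin y := Real.sin_pos_of_pos_of_lt_pi (by linarith) hy
  have h3 : 0 ≤ Real.sin (y - x) :=
    Real.sin_nonneg_of_nonneg_of_le_pi (by linarith) (by linarith)
  rw [Real.sin_sub] at h3
  rw [div_le_div_iff₀ h2 h1]
  linarith

lemma norm_halfCot_sub {x y : ℝ} (hx : 0 < x) (hxy : x ≤ y) (hy : y < Real.pi) :
    ‖halfCot y - halfCot x‖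
      = (Real.cos x / Real.sin x - Real.cos y / Real.sin y) / 2 := by
  have h := cot_le_cot hx hxy hy
  have h1 : halfCot y - halfCot x
      = (((Real.cos y / Real.sin y - Real.cos x / Real.sin x) / 2 : ℝ) : ℂ) * Complex.I := by
    rw [halfCot, halfCot]
    push_cast
    ring
  rw [h1, norm_mul, Complex.norm_I, mul_one, Complex.norm_real, Real.norm_eq_abs,
    abs_of_nonpos (by linarith)]
  ring

/-- The left side is cot(x/2)/2, and tan(x/2) > x/2. This turns the boundary terms of the partial
summation into the constant 1/π of Kusmin–Landau. -/
lemma one_add_cos_div_sin_le {x : ℝ} (hx : 0 < x) (hx' : x < Real.pi) :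
    1 / (2 * Real.sin x) + Real.cos x / Real.sin x / 2 ≤ 1 / x := by
  have h1 : 0 < Real.sin x := Real.sin_pos_of_pos_of_lt_pi hx hx'
  have h2 : 0 < Real.cos (x / 2) :=
    Real.cos_pos_of_mem_Ioo ⟨by linarith [Real.pi_pos], by linarith⟩
  have h3 := Real.lt_tan (x := x / 2) (by linarith) (by linarith)
  rw [Real.tan_eq_sin_div_cos, lt_div_iff₀ h2] at h3
  have h4 : Real.sin x = 2 * Real.sin (x / 2) * Real.cos (x / 2) := by
    rw [← Real.sin_two_mul]
    ring_nf
  have h5 : Real.cos x = 2 * Real.cos (x / 2) ^ 2 - 1 := by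
    rw [← Real.cos_two_mul]
    ring_nf
  have h6 : 1 / (2 * Real.sin x) + Real.cos x / Real.sin x / 2
      = (1 + Real.cos x) / (2 * Real.sin x) := by
    field_simp
  rw [h6, div_le_div_iff₀ (by positivity) hx, h4, h5]
  nlinarith

/-- The Kusmin–Landau inequality, for differences in `(0, 1)`. -/
lemma norm_sum_range_expChar_le_of_pos (f : ℕ → ℝ) (N : ℕ) {u v : ℝ} (hu : 0 < u) (hv : 0 < v)
    (hmono : ∀ n, n + 1 < N → f (n + 1) - f n ≤ f (n + 2) - f (n + 1))
    (hlo : ∀ n, n < N → u ≤ f (n + 1) - f n) (hhi : ∀ n, n < N → f (n + 1) - f n ≤ 1 - v) :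
    ‖∑ n ∈ range N, expChar (f n)‖ ≤ 1 / (Real.pi * u) + 1 / (Real.pi * v) := by
  have hπ := Real.pi_pos
  rcases N with _ | N
  · simp only [range_zero, sum_empty, norm_zero]
    positivity
  set θ : ℕ → ℝ := fun n => Real.pi * (f (n + 1) - f n) with hθ
  have hθpos : ∀ n, n < N + 1 → 0 < θ n := fun n hn =>
    mul_pos hπ (lt_of_lt_of_le hu (hlo n hn))
  have hθlt : ∀ n, n < N + 1 → θ n < Real.pi := fun n hn => by
    have := hhi n hn
    simp only [hθ]
    nlinarith
  have hsin : ∀ n, n < N + 1 → 0 < Real.sin (θ n) := fun n hn =>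
    Real.sin_pos_of_pos_of_lt_pi (hθpos n hn) (hθlt n hn)
  -- Equivalently e(f n) = (e(f n) - e(f(n+1))) · `halfCot (θ n)`: every term is a difference with a
  -- slowly varying coefficient, ready for partial summation.
  have hmul : ∀ n, n < N + 1 →
      expChar (f n) + expChar (f (n + 1)) * halfCot (θ n) = expChar (f n) * halfCot (θ n) := by
    intro n hn
    have h1 := one_sub_expChar_mul_halfCot (x := f (n + 1) - f n) (hsin n hn).ne'
    have h2 : expChar (f (n + 1)) = expChar (f n) * expChar (f (n + 1) - f n) := by
      rw [← expChar_add]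
      ring_nf
    rw [h2]
    linear_combination (-expChar (f n)) * h1
  -- After partial summation the coefficients enter only through their total variation. Since θ
  -- increases and the cotangent decreases on (0, π), that variation telescopes.
  have key : ∀ M, M < N + 1 →
      ‖∑ n ∈ range (M + 1), expChar (f n) + expChar (f (M + 1)) * halfCot (θ M)‖
        ≤ 1 / (2 * Real.sin (θ 0))
          + (Real.cos (θ 0) / Real.sin (θ 0) - Real.cos (θ M) / Real.sin (θ M)) / 2 := by
    intro M
    induction M with
    | zero =>
      intro hM
      rw [sum_range_one, hmul 0 hM, norm_mul, norm_expChar, norm_halfCot (hsin 0 hM)]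
      simp
    | succ M ih =>
      intro hM
      have h1 := ih (by omega)
      have h2 : ∑ n ∈ range (M + 1 + 1), expChar (f n)
            + expChar (f (M + 1 + 1)) * halfCot (θ (M + 1))
          = (∑ n ∈ range (M + 1), expChar (f n) + expChar (f (M + 1)) * halfCot (θ M))
            + expChar (f (M + 1)) * (halfCot (θ (M + 1)) - halfCot (θ M)) := by
        rw [sum_range_succ, add_assoc, hmul (M + 1) hM]
        ring
      have h3 : θ M ≤ θ (M + 1) := mul_le_mul_of_nonneg_left (hmono M (by omega)) hπ.le
      rw [h2]
      refine (norm_add_le _ _).trans ?_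
      rw [norm_mul, norm_expChar, one_mul,
        norm_halfCot_sub (hθpos M (by omega)) h3 (hθlt _ hM)]
      linarith
  have hN := key N (by omega)
  have h1 : ‖∑ n ∈ range (N + 1), expChar (f n)‖
      ≤ ‖∑ n ∈ range (N + 1), expChar (f n) + expChar (f (N + 1)) * halfCot (θ N)‖
        + 1 / (2 * Real.sin (θ N)) := by
    have := norm_sub_le (∑ n ∈ range (N + 1), expChar (f n) + expChar (f (N + 1)) * halfCot (θ N))
      (expChar (f (N + 1)) * halfCot (θ N))
    rw [add_sub_cancel_right, norm_mul, norm_expChar, one_mul,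
      norm_halfCot (hsin N (by omega))] at this
    exact this
  have h2 := one_add_cos_div_sin_le (hθpos 0 (by omega)) (hθlt 0 (by omega))
  -- The upper endpoint is treated by the reflection θ ↦ π - θ, which reverses the sign of the
  -- cotangent.
  have h3 := one_add_cos_div_sin_le (x := Real.pi - θ N)
    (by linarith [hθlt N (by omega)]) (by linarith [hθpos N (by omega)])
  rw [Real.sin_pi_sub, Real.cos_pi_sub, neg_div, neg_div] at h3
  have h4 : 1 / θ 0 ≤ 1 / (Real.pi * u) :=
    one_div_le_one_div_of_le (by positivity) (mul_le_mul_of_nonneg_left (hlo 0 (by omega)) hπ.le)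
  have h5 : 1 / (Real.pi - θ N) ≤ 1 / (Real.pi * v) := by
    refine one_div_le_one_div_of_le (by positivity) ?_
    have := mul_le_mul_of_nonneg_left (hhi N (by omega)) hπ.le
    simp only [hθ]
    linarith
  linarith

/-- The Kusmin–Landau inequality. -/
lemma norm_sum_Ico_expChar_le (f : ℕ → ℝ) (i j : ℕ) (m : ℤ) {u v : ℝ} (hu : 0 < u) (hv : 0 < v)
    (hmono : ∀ n, i ≤ n → n + 1 < j → f (n + 1) - f n ≤ f (n + 2) - f (n + 1))
    (hlo : ∀ n, i ≤ n → n < j → m + u ≤ f (n + 1) - f n)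
    (hhi : ∀ n, i ≤ n → n < j → f (n + 1) - f n ≤ m + 1 - v) :
    ‖∑ n ∈ Ico i j, expChar (f n)‖ ≤ 1 / (Real.pi * u) + 1 / (Real.pi * v) := by
  -- Subtracting m·n from the phase leaves every e(f n) unchanged and moves the differences into (0,
  -- 1).
  have h := norm_sum_range_expChar_le_of_pos (fun n => f (i + n) - m * n) (j - i) hu hv
    (fun n hn => by
      have := hmono (i + n) (by omega) (by omega)
      push_cast
      simp only [← add_assoc]
      linarith)
    (fun n hn => by
      have := hlo (i + n) (by omega) (by omega)
      push_cast
      simp only [← add_assoc]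
      linarith)
    (fun n hn => by
      have := hhi (i + n) (by omega) (by omega)
      push_cast
      simp only [← add_assoc]
      linarith)
  rw [sum_Ico_eq_sum_range]
  refine le_of_eq_of_le ?_ h
  congr 1
  refine sum_congr rfl fun n _ => ?_
  have : f (i + n) - m * n = f (i + n) + ((-(m * n) : ℤ) : ℝ) := by
    push_cast
    ring
  rw [this, expChar_add, expChar_intCast, mul_one]

/-! ### The second derivative test for sequences. -/

lemma exists_split_of_monotone (g : ℕ → ℝ) {i j : ℕ} (hij : i ≤ j)
    (hmono : ∀ n, i ≤ n → n + 1 < j → g n ≤ g (n + 1)) (τ : ℝ) :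
    ∃ k, i ≤ k ∧ k ≤ j ∧ (∀ n, i ≤ n → n < k → g n < τ) ∧ ∀ n, k ≤ n → n < j → τ ≤ g n := by
  induction j, hij using Nat.le_induction with
  | base => exact ⟨i, le_rfl, le_rfl, fun n h1 h2 => by omega, fun n h1 h2 => by omega⟩
  | succ j hij ih =>
    obtain ⟨k, h1, h2, h3, h4⟩ := ih fun n hn hn' => hmono n hn (by omega)
    by_cases hk : k = j ∧ g j < τ
    · refine ⟨j + 1, by omega, le_rfl, fun n hn hn' => ?_, fun n hn hn' => by omega⟩
      rcases Nat.lt_or_ge n j with h | h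
      · exact h3 n hn (by omega)
      · rw [show n = j by omega]
        exact hk.2
    · refine ⟨k, h1, by omega, h3, fun n hn hn' => ?_⟩
      rcases Nat.lt_or_ge n j with h | h
      · exact h4 n hn h
      · obtain rfl : n = j := by omega
        rcases Nat.lt_or_ge k n with h' | h'
        · obtain ⟨l, rfl⟩ : ∃ l, n = l + 1 := ⟨n - 1, by omega⟩
          exact (h4 l (by omega) (by omega)).trans (hmono l (by omega) (by omega))
        · by_contra h''
          exact hk ⟨by omega, by linarith⟩

lemma add_mul_le_of_step {g : ℕ → ℝ} {lam : ℝ} {i j : ℕ} (hij : i ≤ j)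
    (hstep : ∀ n, i ≤ n → n < j → g n + lam ≤ g (n + 1)) :
    g i + lam * (j - i : ℝ) ≤ g j := by
  induction j, hij using Nat.le_induction with
  | base => simp
  | succ j hij ih =>
    have h1 := ih fun n hn hn' => hstep n hn (by omega)
    have h2 := hstep j hij (by omega)
    push_cast
    linarith

lemma le_add_mul_of_step {g : ℕ → ℝ} {lam : ℝ} {i j : ℕ} (hij : i ≤ j)
    (hstep : ∀ n, i ≤ n → n < j → g (n + 1) ≤ g n + lam) :
    g j ≤ g i + lam * (j - i : ℝ) := by
  induction j, hij using Nat.le_induction with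
  | base => simp
  | succ j hij ih =>
    have h1 := ih fun n hn hn' => hstep n hn (by omega)
    have h2 := hstep j hij (by omega)
    push_cast
    linarith

/-- A sum over indices where the differences lie in a short interval is short. -/
lemma norm_sum_Ico_le_of_mem_Ico (f : ℕ → ℝ) {lam : ℝ} (hlam : 0 < lam) (i j : ℕ) {c d : ℝ}
    (hd : 0 ≤ d)
    (hstep : ∀ n, i ≤ n → n + 1 < j → f (n + 1) - f n + lam ≤ f (n + 2) - f (n + 1))
    (hlo : ∀ n, i ≤ n → n < j → c ≤ f (n + 1) - f n)
    (hhi : ∀ n, i ≤ n → n < j → f (n + 1) - f n ≤ c + d) :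
    ‖∑ n ∈ Ico i j, expChar (f n)‖ ≤ d / lam + 1 := by
  refine (norm_sum_expChar_le_card f _).trans ?_
  rw [Nat.card_Ico]
  rcases Nat.lt_or_ge i j with h | h
  · have h1 := add_mul_le_of_step (g := fun n => f (n + 1) - f n) (i := i) (j := j - 1)
      (by omega) fun n hn hn' => hstep n hn (by omega)
    have h2 := hlo i le_rfl h
    have h3 := hhi (j - 1) (by omega) (by omega)
    have h4 : lam * ((j - 1 : ℕ) - i : ℝ) ≤ d := by
      linarith
    rw [← sub_le_iff_le_add, le_div_iff₀ hlam]
    push_cast [Nat.cast_sub h.le, Nat.cast_sub (show 1 ≤ j by omega)] at h4 ⊢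
    linarith
  · rw [Nat.sub_eq_zero_of_le h]
    simp only [Nat.cast_zero]
    positivity

lemma norm_sum_Ico_split {f : ℕ → ℂ} {i k j : ℕ} (h1 : i ≤ k) (h2 : k ≤ j) {x y : ℝ}
    (hx : ‖∑ n ∈ Ico i k, f n‖ ≤ x) (hy : ‖∑ n ∈ Ico k j, f n‖ ≤ y) :
    ‖∑ n ∈ Ico i j, f n‖ ≤ x + y := by
  rw [← sum_Ico_consecutive _ h1 h2]
  exact (norm_add_le _ _).trans (add_le_add hx hy)

/-- A sum over indices where the differences run from just below `m` to just above `m + J`. -/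
lemma norm_sum_Ico_le_of_mem_Ico_int (f : ℕ → ℝ) {lam D : ℝ} (hlam : 0 < lam) (hD : 0 < D)
    (m : ℤ) (J : ℕ) : ∀ i j : ℕ, i ≤ j →
    (∀ n, i ≤ n → n + 1 < j → f (n + 1) - f n + lam ≤ f (n + 2) - f (n + 1)) →
    (∀ n, i ≤ n → n < j → m - D ≤ f (n + 1) - f n) →
    (∀ n, i ≤ n → n < j → f (n + 1) - f n < m + J + D) →
    ‖∑ n ∈ Ico i j, expChar (f n)‖
      ≤ (J + 1) * (2 * D / lam + 1) + J * (1 / (Real.pi * D) + 1 / (Real.pi * D)) := by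
  induction J with
  | zero =>
    intro i j hij hstep hlo hhi
    have := norm_sum_Ico_le_of_mem_Ico f hlam i j (c := m - D) (d := 2 * D) (by positivity) hstep hlo
      fun n hn hn' => by
        have := hhi n hn hn'
        push_cast at this
        linarith
    simpa using this
  | succ J ih =>
    intro i j hij hstep hlo hhi
    have hmono : ∀ n, i ≤ n → n + 1 < j → f (n + 1) - f n ≤ f (n + 2) - f (n + 1) :=
      fun n hn hn' => by linarith [hstep n hn hn']
    -- The last gap between integers (Kusmin–Landau) and the window of radius D about m + J + 1
    -- (trivial bound) are split off; the rest is the induction hypothesis.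
    obtain ⟨k, hk1, hk2, hk3, hk4⟩ :=
      exists_split_of_monotone (fun n => f (n + 1) - f n) hij hmono (m + J + D)
    obtain ⟨l, hl1, hl2, hl3, hl4⟩ :=
      exists_split_of_monotone (fun n => f (n + 1) - f n) hk2
        (fun n hn hn' => hmono n (by omega) hn') (m + J + 1 - D)
    have h1 := ih i k hk1 (fun n hn hn' => hstep n hn (by omega))
      (fun n hn hn' => hlo n hn (by omega)) hk3
    have h2 := norm_sum_Ico_expChar_le f k l (m + J) hD hD
      (fun n hn hn' => hmono n (by omega) (by omega))
      (fun n hn hn' => by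
        push_cast
        exact hk4 n hn (by omega))
      (fun n hn hn' => by
        push_cast
        exact (hl3 n hn hn').le)
    have h3 := norm_sum_Ico_le_of_mem_Ico f hlam l j (c := m + J + 1 - D) (d := 2 * D)
      (by positivity) (fun n hn hn' => hstep n (by omega) hn') hl4
      fun n hn hn' => by
        have := hhi n (by omega) hn'
        push_cast at this
        linarith
    have h4 := norm_sum_Ico_split hk1 hk2 h1 (norm_sum_Ico_split hl1 hl2 h2 h3)
    refine h4.trans (le_of_eq ?_)
    push_cast
    ring

/-- Here 4y(1 - y) ≥ 4D(1 - D) ≥ D. An incomplete gap of length y at an end of the range is thereby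
charged in proportion to y, which keeps the final bound linear in the total variation V. -/
lemma one_div_one_sub_le {D y : ℝ} (hD : 0 < D) (hD' : D ≤ 1 / 4) (hy : D ≤ y) (hy' : y ≤ 1 - D) :
    1 / (Real.pi * (1 - y)) ≤ y * (4 / (Real.pi * D)) := by
  have hπ := Real.pi_pos
  have h : 0 < 1 - y := by linarith
  have h1 : y * (4 / (Real.pi * D)) = (4 * y) / (Real.pi * D) := by ring
  rw [h1, div_le_div_iff₀ (by positivity) (by positivity)]
  have h2 : D ≤ 4 * y * (1 - y) := by nlinarith
  nlinarith

/-- The second derivative test for the sequence of differences, in the nontrivial range. -/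
lemma norm_sum_Ico_expChar_le_of_small (f : ℕ → ℝ) {lam D : ℝ} (hlam : 0 < lam) (hD : 0 < D)
    (hD' : D ≤ 1 / 4) (hDlam : Real.pi * D ^ 2 = lam) {i j : ℕ} (hij : i < j)
    (hstep : ∀ n, i ≤ n → n + 1 < j → f (n + 1) - f n + lam ≤ f (n + 2) - f (n + 1)) {V : ℝ}
    (hV : (f (j - 1 + 1) - f (j - 1)) - (f (i + 1) - f i) = V) :
    ‖∑ n ∈ Ico i j, expChar (f n)‖ ≤ (V + 1) * (4 / (Real.pi * D)) + V + 2 := by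
  have hπ := Real.pi_pos
  have hmono : ∀ n, i ≤ n → n + 1 < j → f (n + 1) - f n ≤ f (n + 2) - f (n + 1) :=
    fun n hn hn' => by linarith [hstep n hn hn']
  set α := f (i + 1) - f i with hα
  set β := f (j - 1 + 1) - f (j - 1) with hβ
  have hge : ∀ n, i ≤ n → n < j → α ≤ f (n + 1) - f n := fun n hn hn' => by
    have := add_mul_le_of_step (g := fun n => f (n + 1) - f n) (lam := 0) hn
      fun k hk hk' => by simpa using hmono k hk (by omega)
    linarith
  have hle : ∀ n, i ≤ n → n < j → f (n + 1) - f n ≤ β := fun n hn hn' => by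
    have := add_mul_le_of_step (g := fun n => f (n + 1) - f n) (lam := 0) (i := n) (j := j - 1)
      (by omega) fun k hk hk' => by simpa using hmono k (by omega) (by omega)
    linarith
  have hVnn : 0 ≤ V := by
    have := hge (j - 1) (by omega) (by omega)
    linarith
  set E := 4 / (Real.pi * D) with hE
  have hEpos : 0 < E := by positivity
  have hE4 : 1 / (Real.pi * D) = E / 4 := by rw [hE]; ring
  -- The relation λ = πD² minimises 2D/λ + 2/(πD), the cost of one window plus one gap; both then
  -- equal E/2.
  have hElam : 2 * D / lam = E / 2 := by
    rw [hE, ← hDlam]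
    field_simp
    norm_num
  -- These are the least m with α < m + D and the greatest m' with m' - D < β, hence the extreme
  -- integers whose D-windows can meet [α, β].
  obtain ⟨m, hm⟩ : ∃ m : ℤ, m = ⌊α - D⌋ + 1 := ⟨_, rfl⟩
  obtain ⟨m', hm'⟩ : ∃ m' : ℤ, m' = ⌈β + D⌉ - 1 := ⟨_, rfl⟩
  have hm1 : (m : ℝ) - 1 + D ≤ α := by
    have := Int.floor_le (α - D)
    rw [hm]
    push_cast
    linarith
  have hm2 : α < m + D := by
    have := Int.lt_floor_add_one (α - D)
    rw [hm]
    push_cast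
    linarith
  have hm1' : (m' : ℝ) < β + D := by
    have := Int.ceil_lt_add_one (β + D)
    rw [hm']
    push_cast
    linarith
  have hm2' : β + D ≤ m' + 1 := by
    have := Int.le_ceil (β + D)
    rw [hm']
    push_cast
    linarith
  -- When m' < m all differences lie in [m - 1 + D, m - D], and one application of Kusmin–Landau
  -- suffices.
  rcases lt_or_ge m' m with hlt | hlt
  · have hlt' : (m' : ℝ) + 1 ≤ m := by exact_mod_cast hlt
    have h := norm_sum_Ico_expChar_le f i j (m - 1) hD hD hmono
      (fun n hn hn' => by
        have := hge n hn hn'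
        push_cast
        linarith)
      (fun n hn hn' => by
        have := hle n hn hn'
        push_cast
        linarith)
    rw [hE4] at h
    nlinarith [mul_nonneg hVnn hEpos.le]
  · obtain ⟨J, hJ⟩ : ∃ J : ℕ, m' = m + J := ⟨(m' - m).toNat, by omega⟩
    have hJ' : (m' : ℝ) = m + J := by rw [hJ]; push_cast; ring
    obtain ⟨k, hk1, hk2, hk3, hk4⟩ :=
      exists_split_of_monotone (fun n => f (n + 1) - f n) hij.le hmono (m - D)
    obtain ⟨l, hl1, hl2, hl3, hl4⟩ :=
      exists_split_of_monotone (fun n => f (n + 1) - f n) hk2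
        (fun n hn hn' => hmono n (by omega) hn') (m + J + D)
    have hleft : ‖∑ n ∈ Ico i k, expChar (f n)‖ ≤ (m - α) * E + E / 4 := by
      rcases hk1.eq_or_lt with h | h
      · rw [← h, Ico_self, sum_empty, norm_zero]
        nlinarith
      · have h1 := hk3 i le_rfl h
        have h2 := norm_sum_Ico_expChar_le f i k (m - 1) (u := 1 - (m - α)) (v := D)
          (by linarith) hD (fun n hn hn' => hmono n hn (by omega))
          (fun n hn hn' => by
            have := hge n hn (by omega)
            push_cast
            linarith)
          (fun n hn hn' => by
            have := hk3 n hn hn'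
            push_cast
            linarith)
        have h3 := one_div_one_sub_le hD hD' (y := m - α) (by linarith) (by linarith)
        rw [hE4] at h2
        linarith
    have hright : ‖∑ n ∈ Ico l j, expChar (f n)‖ ≤ (β - m') * E + E / 4 := by
      rcases hl2.eq_or_lt with h | h
      · rw [h, Ico_self, sum_empty, norm_zero]
        nlinarith
      · have h1 := hl4 (j - 1) (by omega) (by omega)
        have h2 := norm_sum_Ico_expChar_le f l j m' (u := D) (v := 1 - (β - m'))
          hD (by linarith) (fun n hn hn' => hmono n (by omega) (by omega))
          (fun n hn hn' => by
            have := hl4 n hn (by omega)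
            linarith)
          (fun n hn hn' => by
            have := hle n (by omega) hn'
            linarith)
        have h3 := one_div_one_sub_le hD hD' (y := β - m') (by linarith) (by linarith)
        rw [hE4] at h2
        linarith
    have hmid := norm_sum_Ico_le_of_mem_Ico_int f hlam hD m J k l hl1
      (fun n hn hn' => hstep n (by omega) (by omega))
      (fun n hn hn' => hk4 n hn (by omega)) hl3
    rw [hE4, hElam] at hmid
    have h := norm_sum_Ico_split hk1 hk2 hleft (norm_sum_Ico_split hl1 hl2 hmid hright)
    have hVJ : V = J + (m - α) + (β - m') := by
      rw [hJ', ← hV]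
      ring
    refine h.trans ?_
    have : (J : ℝ) + 1 ≤ V + 2 := by linarith
    have e : (m - α) * E + E / 4 + ((J + 1) * (E / 2 + 1) + J * (E / 4 + E / 4)
        + ((β - m') * E + E / 4)) = (V + 1) * E + (J + 1) := by
      rw [hVJ]
      ring
    rw [e]
    linarith

/-- The second derivative test, for sequences. -/
lemma norm_sum_range_expChar_le_of_diff_two (f : ℕ → ℝ) (N : ℕ) {lam H : ℝ} (hlam : 0 < lam)
    (hH : 0 ≤ H)
    (hlo : ∀ n, n + 2 < N → lam ≤ f (n + 2) - 2 * f (n + 1) + f n)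
    (hhi : ∀ n, n + 2 < N → f (n + 2) - 2 * f (n + 1) + f n ≤ H * lam) :
    ‖∑ n ∈ range N, expChar (f n)‖
      ≤ (H * lam * N + 1) * (4 / √(Real.pi * lam)) + H * lam * N + 3 := by
  have hπ := Real.pi_pos
  rcases Nat.lt_or_ge N 2 with hN | hN
  · have h := norm_sum_expChar_le_card f (range N)
    rw [card_range] at h
    have h1 : (N : ℝ) ≤ 1 := by exact_mod_cast (by omega : N ≤ 1)
    have h2 : 0 ≤ (H * lam * N + 1) * (4 / √(Real.pi * lam)) + H * lam * N := by positivity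
    linarith
  obtain ⟨M, rfl⟩ : ∃ M, N = M + 1 := ⟨N - 1, by omega⟩
  -- Kusmin–Landau uses the difference following the last summand, but nothing is assumed about
  -- f(N); the last term is therefore bounded by 1.
  have hlast : ‖∑ n ∈ range (M + 1), expChar (f n)‖ ≤ ‖∑ n ∈ Ico 0 M, expChar (f n)‖ + 1 := by
    rw [sum_range_succ, range_eq_Ico]
    refine (norm_add_le _ _).trans ?_
    rw [norm_expChar]
  set D := √(lam / Real.pi) with hD
  have hDpos : 0 < D := Real.sqrt_pos.2 (by positivity)
  have hD2 : Real.pi * D ^ 2 = lam := by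
    rw [hD, Real.sq_sqrt (by positivity)]
    field_simp
  have hsqrt : √(Real.pi * lam) = Real.pi * D := by
    rw [← hD2, show Real.pi * (Real.pi * D ^ 2) = (Real.pi * D) ^ 2 by ring,
      Real.sqrt_sq (by positivity)]
  set V := (f (M - 1 + 1) - f (M - 1)) - (f (0 + 1) - f 0) with hV
  have hVle : V ≤ H * lam * M := by
    have := le_add_mul_of_step (g := fun n => f (n + 1) - f n) (lam := H * lam) (i := 0)
      (j := M - 1) (by omega) fun n _ hn' => by
        have := hhi n (by omega)
        linarith
    have h1 : H * lam * (M - 1 : ℕ) ≤ H * lam * M := by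
      gcongr
      omega
    simp only [Nat.cast_zero, sub_zero] at this
    linarith
  have hVge : lam * (M - 1 : ℝ) ≤ V := by
    have := add_mul_le_of_step (g := fun n => f (n + 1) - f n) (lam := lam) (i := 0)
      (j := M - 1) (by omega) fun n _ hn' => by
        have := hlo n (by omega)
        linarith
    push_cast [Nat.cast_sub (show 1 ≤ M by omega)] at this
    linarith
  have hM : (1 : ℝ) ≤ M := by exact_mod_cast (by omega : 1 ≤ M)
  have hVnn : 0 ≤ V := le_trans (by nlinarith) hVge
  have key : ‖∑ n ∈ Ico 0 M, expChar (f n)‖ ≤ (V + 1) * (4 / (Real.pi * D)) + V + 2 := by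
    -- For D > 1/4 the trivial bound is enough, because V ≥ (M - 1)λ and 4λ/(πD) = 4D > 1.
    rcases le_or_gt D (1 / 4) with hD4 | hD4
    · exact norm_sum_Ico_expChar_le_of_small f hlam hDpos hD4 hD2 (by omega)
        (fun n _ hn' => by
          have := hlo n (by omega)
          linarith) rfl
    · have h := norm_sum_expChar_le_card f (Ico 0 M)
      rw [Nat.card_Ico, Nat.sub_zero] at h
      have h1 : (M : ℝ) - 1 ≤ V * (4 / (Real.pi * D)) := by
        rw [mul_div_assoc', le_div_iff₀ (by positivity)]
        have : (M - 1 : ℝ) * (Real.pi * D) ≤ (M - 1) * (4 * lam) := by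
          refine mul_le_mul_of_nonneg_left ?_ (by linarith)
          rw [← hD2]
          nlinarith [mul_pos hπ hDpos]
        linarith
      have h2 : 0 ≤ 4 / (Real.pi * D) := by positivity
      linarith
  have hle : V ≤ H * lam * (M + 1 : ℕ) := hVle.trans (by gcongr; omega)
  rw [hsqrt]
  have h1 : (V + 1) * (4 / (Real.pi * D))
      ≤ (H * lam * (M + 1 : ℕ) + 1) * (4 / (Real.pi * D)) := by gcongr
  linarith

/-! ### Weyl–van der Corput differencing. -/

/-- With truncated subtraction k - l + (l - k) is |k - l|, and each distance r ≥ 1 is attained by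
2(Q - r) ordered pairs. -/
lemma sum_sum_dist (T : ℕ → ℝ) (Q : ℕ) :
    ∑ k ∈ range Q, ∑ l ∈ range Q, T (k - l + (l - k))
      = Q * T 0 + 2 * ∑ r ∈ Ico 1 Q, (Q - r : ℝ) * T r := by
  induction Q with
  | zero => simp
  | succ Q ih =>
    have h1 : ∑ l ∈ range Q, T (Q - l + (l - Q)) = ∑ r ∈ Ico 1 (Q + 1), T r := by
      rw [sum_Ico_eq_sum_range, ← sum_range_reflect]
      refine sum_congr rfl fun l hl => ?_
      rw [mem_range] at hl
      congr 1
      omega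
    have h2 : ∑ k ∈ range Q, T (k - Q + (Q - k)) = ∑ r ∈ Ico 1 (Q + 1), T r := by
      rw [← h1]
      exact sum_congr rfl fun k _ => by rw [add_comm]
    have h3 : ∑ r ∈ Ico 1 (Q + 1), ((Q + 1 : ℕ) - r : ℝ) * T r
        = ∑ r ∈ Ico 1 Q, (Q - r : ℝ) * T r + ∑ r ∈ Ico 1 (Q + 1), T r := by
      rcases Nat.eq_zero_or_pos Q with rfl | hQ
      · simp
      rw [sum_Ico_succ_top hQ, sum_Ico_succ_top hQ, ← add_assoc, ← sum_add_distrib]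
      push_cast
      congr 1
      · exact sum_congr rfl fun r _ => by ring
      · ring
    rw [sum_range_succ, sum_range_succ, h1, h3]
    simp only [sum_range_succ]
    rw [sum_add_distrib, ih, h2]
    simp
    ring

/-- The sequence `z`, cut off to `[0, N)` and shifted by `k`. -/
def shiftSeq (z : ℕ → ℂ) (N k m : ℕ) : ℂ := if k ≤ m ∧ m < N + k then z (m - k) else 0

lemma sum_shiftSeq (z g : ℕ → ℂ) {N M k : ℕ} (h : N + k ≤ M) :
    ∑ m ∈ range M, shiftSeq z N k m * g m = ∑ n ∈ range N, z n * g (n + k) := by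
  have h1 : ∑ m ∈ range M, shiftSeq z N k m * g m
      = ∑ m ∈ Ico k (N + k), shiftSeq z N k m * g m := by
    symm
    refine sum_subset (fun m hm => ?_) fun m _ hm => ?_
    · rw [mem_Ico] at hm
      rw [mem_range]
      omega
    · rw [mem_Ico] at hm
      rw [shiftSeq, if_neg hm, zero_mul]
  rw [h1, sum_Ico_eq_sum_range, Nat.add_sub_cancel]
  refine sum_congr rfl fun n hn => ?_
  rw [mem_range] at hn
  rw [shiftSeq, if_pos (by omega), Nat.add_sub_cancel_left, add_comm k n]

/-- Weyl–van der Corput differencing. -/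
lemma sq_norm_sum_range_le (z : ℕ → ℂ) (N Q : ℕ) (hQ : 1 ≤ Q) (T : ℕ → ℝ)
    (hT : ∀ r, ‖∑ n ∈ range (N - r), z (n + r) * (starRingEnd ℂ) (z n)‖ ≤ T r) :
    (Q : ℝ) ^ 2 * ‖∑ n ∈ range N, z n‖ ^ 2
      ≤ (N + Q - 1) * (Q * T 0 + 2 * ∑ r ∈ Ico 1 Q, (Q - r : ℝ) * T r) := by
  set M := N + Q - 1 with hM
  set x : ℕ → ℂ := fun m => ∑ k ∈ range Q, shiftSeq z N k m with hx
  -- Each z n occurs in exactly Q of the shifted copies, which are all supported in N + Q - 1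
  -- positions. Cauchy–Schwarz over these positions gives the factor N + Q - 1.
  have hsum : ∑ m ∈ range M, x m = Q * ∑ n ∈ range N, z n := by
    simp only [hx]
    rw [sum_comm]
    have : ∀ k ∈ range Q, ∑ m ∈ range M, shiftSeq z N k m = ∑ n ∈ range N, z n := by
      intro k hk
      rw [mem_range] at hk
      simpa using sum_shiftSeq z (fun _ => 1) (N := N) (M := M) (k := k) (by omega)
    rw [sum_congr rfl this]
    simp
  have hcs : ‖∑ m ∈ range M, x m‖ ^ 2 ≤ M * ∑ m ∈ range M, ‖x m‖ ^ 2 := by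
    have h1 : ‖∑ m ∈ range M, x m‖ ^ 2 ≤ (∑ m ∈ range M, ‖x m‖) ^ 2 := by
      gcongr
      exact norm_sum_le _ _
    have h2 := sq_sum_le_card_mul_sum_sq (s := range M) (f := fun m => ‖x m‖)
    rw [card_range] at h2
    exact h1.trans h2
  have hcorr : ∀ k l, k ≤ l → l < Q →
      ∑ m ∈ range M, shiftSeq z N l m * (starRingEnd ℂ) (shiftSeq z N k m)
        = (starRingEnd ℂ)
            (∑ n ∈ range (N - (l - k)), z (n + (l - k)) * (starRingEnd ℂ) (z n)) := by
    intro k l hkl hl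
    rw [sum_shiftSeq z (fun m => (starRingEnd ℂ) (shiftSeq z N k m)) (by omega), map_sum]
    symm
    have h1 : ∀ n ∈ range (N - (l - k)),
        (starRingEnd ℂ) (z (n + (l - k)) * (starRingEnd ℂ) (z n))
          = z n * (starRingEnd ℂ) (shiftSeq z N k (n + l)) := by
      intro n hn
      rw [mem_range] at hn
      rw [shiftSeq, if_pos (by omega), map_mul, Complex.conj_conj, mul_comm]
      congr 3
      omega
    rw [sum_congr rfl h1]
    refine sum_subset (fun n hn => ?_) fun n _ hn => ?_
    · rw [mem_range] at hn ⊢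
      omega
    · rw [mem_range] at hn
      rw [shiftSeq, if_neg (by omega), map_zero, mul_zero]
  have hnorm : ∀ k l, k < Q → l < Q →
      ‖∑ m ∈ range M, shiftSeq z N l m * (starRingEnd ℂ) (shiftSeq z N k m)‖
        ≤ T (k - l + (l - k)) := by
    intro k l hk hl
    rcases le_total k l with h | h
    · rw [hcorr k l h hl, RCLike.norm_conj, Nat.sub_eq_zero_of_le h, zero_add]
      exact hT _
    · have h1 : ∑ m ∈ range M, shiftSeq z N l m * (starRingEnd ℂ) (shiftSeq z N k m)
          = (starRingEnd ℂ)
            (∑ m ∈ range M, shiftSeq z N k m * (starRingEnd ℂ) (shiftSeq z N l m)) := by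
        rw [map_sum]
        refine sum_congr rfl fun m _ => ?_
        rw [map_mul, Complex.conj_conj, mul_comm]
      rw [h1, hcorr l k h hk, RCLike.norm_conj, RCLike.norm_conj, Nat.sub_eq_zero_of_le h,
        add_zero]
      exact hT _
  have hsq : ∑ m ∈ range M, ‖x m‖ ^ 2
      ≤ ∑ k ∈ range Q, ∑ l ∈ range Q, T (k - l + (l - k)) := by
    have h1 : ((∑ m ∈ range M, ‖x m‖ ^ 2 : ℝ) : ℂ)
        = ∑ k ∈ range Q, ∑ l ∈ range Q,
          ∑ m ∈ range M, shiftSeq z N l m * (starRingEnd ℂ) (shiftSeq z N k m) := by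
      have h2 : ∀ k ∈ range Q, ∑ l ∈ range Q,
          ∑ m ∈ range M, shiftSeq z N l m * (starRingEnd ℂ) (shiftSeq z N k m)
          = ∑ m ∈ range M, x m * (starRingEnd ℂ) (shiftSeq z N k m) := by
        intro k _
        rw [sum_comm]
        exact sum_congr rfl fun m _ => by rw [hx, sum_mul]
      rw [sum_congr rfl h2, sum_comm]
      push_cast
      refine sum_congr rfl fun m _ => ?_
      rw [← mul_sum, ← map_sum, Complex.mul_conj, Complex.normSq_eq_norm_sq]
      push_cast
      rfl
    have h3 : ∑ m ∈ range M, ‖x m‖ ^ 2 = ‖((∑ m ∈ range M, ‖x m‖ ^ 2 : ℝ) : ℂ)‖ := by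
      rw [Complex.norm_real, Real.norm_eq_abs, abs_of_nonneg]
      positivity
    rw [h3, h1]
    refine (norm_sum_le _ _).trans (sum_le_sum fun k hk => ?_)
    refine (norm_sum_le _ _).trans (sum_le_sum fun l hl => ?_)
    exact hnorm k l (mem_range.1 hk) (mem_range.1 hl)
  rw [sum_sum_dist] at hsq
  rw [hsum, norm_mul, mul_pow, Complex.norm_natCast] at hcs
  have hMc : (M : ℝ) = N + Q - 1 := by
    rw [hM]
    push_cast [Nat.cast_sub (show 1 ≤ N + Q by omega)]
    ring
  rw [← hMc]
  exact hcs.trans (mul_le_mul_of_nonneg_left hsq (Nat.cast_nonneg _))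

/-- Weyl–van der Corput differencing for exponential sums. -/
lemma sq_norm_sum_range_expChar_le (f : ℕ → ℝ) (N Q : ℕ) (hQ : 1 ≤ Q) (T : ℕ → ℝ)
    (hT : ∀ r, 1 ≤ r → r < Q →
      ‖∑ n ∈ range (N - r), expChar (f (n + r) - f n)‖ ≤ T r) :
    (Q : ℝ) ^ 2 * ‖∑ n ∈ range N, expChar (f n)‖ ^ 2
      ≤ (N + Q - 1) * (Q * N + 2 * ∑ r ∈ Ico 1 Q, (Q - r : ℝ) * T r) := by
  have hz : ∀ r n, expChar (f (n + r)) * (starRingEnd ℂ) (expChar (f n))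
      = expChar (f (n + r) - f n) := fun r n => by
    rw [conj_expChar, ← expChar_add, sub_eq_add_neg]
  have h := sq_norm_sum_range_le (fun n => expChar (f n)) N Q hQ
    (fun r => ‖∑ n ∈ range (N - r), expChar (f (n + r) - f n)‖) fun r => by
      simp only [hz]
      exact le_rfl
  have hQ' : (1 : ℝ) ≤ Q := by exact_mod_cast hQ
  refine h.trans (mul_le_mul_of_nonneg_left ?_ (by linarith [(Nat.cast_nonneg N : (0 : ℝ) ≤ N)]))
  refine add_le_add (mul_le_mul_of_nonneg_left ?_ (by positivity))
    (mul_le_mul_of_nonneg_left (sum_le_sum fun r hr => ?_) (by norm_num))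
  · simpa using norm_sum_expChar_le_card (fun n => f (n + 0) - f n) (range (N - 0))
  · rw [mem_Ico] at hr
    have : (r : ℝ) ≤ Q := by exact_mod_cast hr.2.le
    exact mul_le_mul_of_nonneg_left (hT r hr.1 hr.2) (by linarith)

/-! ### Weighted power sums arising from differencing. -/

/-- The trapezoidal rule underestimates the integral of a concave function. -/
lemma trapezoid_le_integral {φ : ℝ → ℝ} (hφ : ConcaveOn ℝ (Set.Ici 0) φ)
    (hc : ∀ a b : ℝ, IntervalIntegrable φ MeasureTheory.volume a b) {x : ℝ} (hx : 0 ≤ x) :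
    (φ x + φ (x + 1)) / 2 ≤ ∫ y in x..x + 1, φ y := by
  have h1 : ∫ y in x..x + 1, (φ x + (y - x) * (φ (x + 1) - φ x)) = (φ x + φ (x + 1)) / 2 := by
    rw [intervalIntegral.integral_add (by simp) (by
      apply Continuous.intervalIntegrable
      fun_prop), intervalIntegral.integral_mul_const,
      intervalIntegral.integral_comp_sub_right (fun y => y)]
    simp
    ring
  rw [← h1]
  refine intervalIntegral.integral_mono_on (by linarith) ?_ (hc _ _) fun y hy => ?_
  · apply Continuous.intervalIntegrable
    fun_prop
  · have h2 := hφ.2 (Set.mem_Ici.2 hx) (Set.mem_Ici.2 (show 0 ≤ x + 1 by linarith))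
      (show 0 ≤ 1 - (y - x) by linarith [hy.2]) (show 0 ≤ y - x by linarith [hy.1]) (by ring)
    simp only [smul_eq_mul] at h2
    have h3 : (1 - (y - x)) * x + (y - x) * (x + 1) = y := by ring
    rw [h3] at h2
    linarith

/-- The function Q x^p - x^(p+1) is concave and vanishes at 0 and Q, so the sum is its trapezoidal
sum on [0, Q], hence at most its integral. -/
lemma sum_sub_mul_rpow_le_of_pos {p : ℝ} (hp : 0 < p) (hp1 : p ≤ 1) (Q : ℕ) :
    ∑ r ∈ Ico 1 Q, (Q - r : ℝ) * (r : ℝ) ^ p ≤ (Q : ℝ) ^ (p + 2) / ((p + 1) * (p + 2)) := by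
  rcases Nat.eq_zero_or_pos Q with rfl | hQ
  · simp only [zero_le, Ico_eq_empty_of_le, sum_empty]
    positivity
  have hQ' : (0 : ℝ) < Q := by exact_mod_cast hQ
  set φ : ℝ → ℝ := fun x => Q * x ^ p - x ^ (p + 1) with hφ
  have hconc : ConcaveOn ℝ (Set.Ici 0) φ :=
    ((Real.concaveOn_rpow hp.le hp1).smul hQ'.le).sub (convexOn_rpow (by linarith))
  have hint : ∀ q : ℝ, 0 < q → ∀ a b : ℝ,
      IntervalIntegrable (fun x : ℝ => x ^ q) MeasureTheory.volume a b := fun q hq a b =>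
    intervalIntegral.intervalIntegrable_rpow' (by linarith)
  have hφint : ∀ a b : ℝ, IntervalIntegrable φ MeasureTheory.volume a b := fun a b =>
    ((hint p hp a b).const_mul _).sub (hint (p + 1) (by linarith) a b)
  have hφ0 : φ 0 = 0 := by
    simp only [hφ]
    rw [Real.zero_rpow hp.ne', Real.zero_rpow (by linarith)]
    ring
  have hφQ : φ Q = 0 := by
    simp only [hφ]
    rw [Real.rpow_add_one hQ'.ne']
    ring
  have h1 : ∑ r ∈ range Q, (φ r + φ (r + 1)) / 2 ≤ ∫ y in (0 : ℝ)..Q, φ y := by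
    have := intervalIntegral.sum_integral_adjacent_intervals (a := fun k : ℕ => (k : ℝ))
      (n := Q) (f := φ) (μ := MeasureTheory.volume) fun k _ => hφint _ _
    rw [Nat.cast_zero] at this
    rw [← this]
    refine sum_le_sum fun r _ => ?_
    push_cast
    exact trapezoid_le_integral hconc hφint (Nat.cast_nonneg r)
  have h2 : ∑ r ∈ range Q, (φ r + φ (r + 1)) / 2 = ∑ r ∈ Ico 1 Q, (Q - r : ℝ) * (r : ℝ) ^ p := by
    have e1 : ∑ r ∈ range Q, φ r = ∑ r ∈ Ico 1 Q, φ r := by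
      rw [range_eq_Ico, sum_eq_sum_Ico_succ_bot hQ]
      simp [hφ0]
    have e2 : ∑ r ∈ range Q, φ (r + 1) = ∑ r ∈ Ico 1 Q, φ r := by
      have := sum_range_succ (fun r : ℕ => φ r) Q
      rw [sum_range_succ', hφQ] at this
      simp only [Nat.cast_zero, hφ0, add_zero] at this
      rw [← e1, ← this]
      push_cast
      rfl
    rw [← sum_div, sum_add_distrib, e1, e2, add_self_div_two]
    refine sum_congr rfl fun r hr => ?_
    rw [mem_Ico] at hr
    simp only [hφ]
    rw [Real.rpow_add_one (by exact_mod_cast (by omega : r ≠ 0))]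
    ring
  have h3 : ∫ y in (0 : ℝ)..Q, φ y = (Q : ℝ) ^ (p + 2) / ((p + 1) * (p + 2)) := by
    simp only [hφ]
    rw [intervalIntegral.integral_sub ((hint p hp _ _).const_mul _)
      (hint (p + 1) (by linarith) _ _), intervalIntegral.integral_const_mul,
      integral_rpow (Or.inl (by linarith)), integral_rpow (Or.inl (by linarith)),
      Real.zero_rpow (by linarith), Real.zero_rpow (by linarith),
      show p + 2 = p + 1 + 1 by ring, Real.rpow_add_one hQ'.ne' (p + 1)]
    have : p + 1 ≠ 0 := by linarith
    have : p + 1 + 1 ≠ 0 := by linarith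
    field_simp
    ring
  linarith

/-- For p < 0 the function (Q - x) x^p decreases on (0, Q], so each term is at most the integral
over the preceding unit interval. The antiderivative Φ is continuous at 0, and the mean value
theorem replaces the singular integral. -/
lemma sum_sub_mul_rpow_le_of_neg {p : ℝ} (hp : -1 < p) (hp0 : p < 0) (Q : ℕ) :
    ∑ r ∈ Ico 1 Q, (Q - r : ℝ) * (r : ℝ) ^ p ≤ (Q : ℝ) ^ (p + 2) / ((p + 1) * (p + 2)) := by
  rcases Nat.eq_zero_or_pos Q with rfl | hQ
  · simp only [zero_le, Ico_eq_empty_of_le, sum_empty]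
    have : 0 < p + 1 := by linarith
    have : 0 < p + 2 := by linarith
    positivity
  have hQ' : (0 : ℝ) < Q := by exact_mod_cast hQ
  set Φ : ℝ → ℝ := fun x => Q * (x ^ (p + 1) / (p + 1)) - x ^ (p + 2) / (p + 2) with hΦ
  have hcont : Continuous Φ := by
    have h1 : Continuous fun x : ℝ => x ^ (p + 1) := Real.continuous_rpow_const (by linarith)
    have h2 : Continuous fun x : ℝ => x ^ (p + 2) := Real.continuous_rpow_const (by linarith)
    fun_prop
  have hderiv : ∀ x : ℝ, 0 < x → HasDerivAt Φ ((Q - x) * x ^ p) x := fun x hx => by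
    have h1 := (Real.hasDerivAt_rpow_const (x := x) (p := p + 1) (Or.inl hx.ne')).div_const (p + 1)
    have h2 := (Real.hasDerivAt_rpow_const (x := x) (p := p + 2) (Or.inl hx.ne')).div_const (p + 2)
    refine ((h1.const_mul (Q : ℝ)).sub h2).congr_deriv ?_
    rw [show p + 1 - 1 = p by ring, show p + 2 - 1 = p + 1 by ring, Real.rpow_add_one hx.ne']
    have : p + 1 ≠ 0 := by linarith
    have : p + 2 ≠ 0 := by linarith
    field_simp
  have hstep : ∀ r ∈ range (Q - 1),
      (Q - (r + 1 : ℕ) : ℝ) * ((r + 1 : ℕ) : ℝ) ^ p ≤ Φ (r + 1 : ℕ) - Φ r := by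
    intro r hr
    rw [mem_range] at hr
    have hr0 : (0 : ℝ) ≤ r := Nat.cast_nonneg r
    obtain ⟨c, hc, hc'⟩ := exists_hasDerivAt_eq_slope Φ (fun x => (Q - x) * x ^ p)
      (show (r : ℝ) < (r + 1 : ℕ) by push_cast; linarith) hcont.continuousOn
      fun x hx => hderiv x (lt_of_le_of_lt hr0 hx.1)
    have hcp : 0 < c := lt_of_le_of_lt hr0 hc.1
    have e : (((r + 1 : ℕ) : ℝ) - r) = 1 := by push_cast; ring
    rw [e, div_one] at hc'
    rw [← hc']
    have h1 : ((r + 1 : ℕ) : ℝ) ^ p ≤ c ^ p :=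
      Real.rpow_le_rpow_of_nonpos hcp hc.2.le hp0.le
    have h2 : ((r + 1 : ℕ) : ℝ) ≤ Q := by exact_mod_cast (by omega : r + 1 ≤ Q)
    exact mul_le_mul (by linarith [hc.2]) h1 (by positivity) (by linarith [hc.2])
  have hΦ0 : Φ 0 = 0 := by
    simp only [hΦ]
    rw [Real.zero_rpow (by linarith), Real.zero_rpow (by linarith)]
    simp
  have hlast : Φ (Q - 1 : ℕ) ≤ Φ Q := by
    refine (monotoneOn_of_deriv_nonneg (convex_Icc (0 : ℝ) Q) hcont.continuousOn ?_ ?_)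
      ⟨Nat.cast_nonneg _, by exact_mod_cast Nat.sub_le Q 1⟩ ⟨hQ'.le, le_rfl⟩
      (by exact_mod_cast Nat.sub_le Q 1)
    · intro x hx
      rw [interior_Icc] at hx
      exact (hderiv x hx.1).differentiableAt.differentiableWithinAt
    · intro x hx
      rw [interior_Icc] at hx
      rw [(hderiv x hx.1).deriv]
      exact mul_nonneg (by linarith [hx.2]) (Real.rpow_nonneg hx.1.le _)
  have hsum : ∑ r ∈ Ico 1 Q, (Q - r : ℝ) * (r : ℝ) ^ p ≤ Φ Q := by
    rw [sum_Ico_eq_sum_range]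
    have h1 := sum_le_sum hstep
    rw [sum_range_sub (fun r : ℕ => Φ r), Nat.cast_zero, hΦ0, sub_zero] at h1
    refine le_trans (le_of_eq (sum_congr rfl fun r _ => ?_)) (h1.trans hlast)
    rw [add_comm 1 r]
  refine hsum.trans (le_of_eq ?_)
  simp only [hΦ]
  rw [show p + 2 = p + 1 + 1 by ring, Real.rpow_add_one hQ'.ne' (p + 1)]
  have : p + 1 ≠ 0 := by linarith
  have : p + 1 + 1 ≠ 0 := by linarith
  field_simp
  ring

lemma sum_sub_mul_sqrt_le (Q : ℕ) :
    ∑ r ∈ Ico 1 Q, (Q - r : ℝ) * √r ≤ 4 / 15 * ((Q : ℝ) ^ 2 * √Q) := by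
  have h := sum_sub_mul_rpow_le_of_pos (p := 1 / 2) (by norm_num) (by norm_num) Q
  simp only [← Real.sqrt_eq_rpow] at h
  refine h.trans (le_of_eq ?_)
  rw [Real.rpow_add_of_nonneg (Nat.cast_nonneg Q) (by norm_num) (by norm_num),
    ← Real.sqrt_eq_rpow, Real.rpow_two]
  ring

lemma sum_sub_div_sqrt_le (Q : ℕ) :
    ∑ r ∈ Ico 1 Q, (Q - r : ℝ) * (1 / √r) ≤ 4 / 3 * (Q * √Q) := by
  have h := sum_sub_mul_rpow_le_of_neg (p := -(1 / 2)) (by norm_num) (by norm_num) Q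
  have h1 : ∀ r : ℕ, (r : ℝ) ^ (-(1 / 2) : ℝ) = 1 / √r := fun r => by
    rw [Real.rpow_neg (Nat.cast_nonneg r), ← Real.sqrt_eq_rpow, one_div]
  simp only [h1] at h
  refine h.trans (le_of_eq ?_)
  rw [show (-(1 / 2) + 2 : ℝ) = 1 / 2 + 1 by norm_num,
    Real.rpow_add_of_nonneg (Nat.cast_nonneg Q) (by norm_num) (by norm_num),
    ← Real.sqrt_eq_rpow, Real.rpow_one]
  ring

lemma sum_sub_mul_le (Q : ℕ) : ∑ r ∈ Ico 1 Q, (Q - r : ℝ) * r ≤ 1 / 6 * (Q : ℝ) ^ 3 := by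
  have h := sum_sub_mul_rpow_le_of_pos (p := 1) (by norm_num) le_rfl Q
  simp only [Real.rpow_one] at h
  refine h.trans (le_of_eq ?_)
  rw [show (1 + 2 : ℝ) = (3 : ℕ) by norm_num, Real.rpow_natCast]
  ring

lemma sum_sub_le (Q : ℕ) : ∑ r ∈ Ico 1 Q, (Q - r : ℝ) ≤ 1 / 2 * (Q : ℝ) ^ 2 := by
  have h := sum_sum_dist (fun _ => 1) Q
  simp only [sum_const, card_range, nsmul_eq_mul, mul_one] at h
  nlinarith [(Nat.cast_nonneg Q : (0 : ℝ) ≤ Q)]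

/-! ### The third derivative test for sequences. -/

lemma mul_four_div_sqrt_add {lam H N r : ℝ} (hlam : 0 < lam) (hr : 0 < r) :
    (H * (r * lam) * N + 1) * (4 / √(Real.pi * (r * lam))) + H * (r * lam) * N + 3
      = 4 / √Real.pi * (H * N * √lam) * √r + 4 / (√Real.pi * √lam) * (1 / √r)
        + H * lam * N * r + 3 := by
  have hπ := Real.pi_pos
  rw [Real.sqrt_mul hπ.le, Real.sqrt_mul hr.le]
  have h1 : 0 < √Real.pi := Real.sqrt_pos.2 hπ
  have h2 : 0 < √lam := Real.sqrt_pos.2 hlam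
  have h3 : 0 < √r := Real.sqrt_pos.2 hr
  have h4 : √lam * √lam = lam := Real.mul_self_sqrt hlam.le
  have h5 : √r * √r = r := Real.mul_self_sqrt hr.le
  generalize √lam = l at *
  generalize √r = q at *
  subst h4 h5
  field_simp

/-- Differencing once and applying the second derivative test. -/
lemma sq_mul_sq_norm_le_of_diff_three (f : ℕ → ℝ) (N Q : ℕ) (hQ : 1 ≤ Q) {lam H : ℝ}
    (hlam : 0 < lam) (hH : 0 ≤ H)
    (hlo : ∀ n, n + 3 < N → lam ≤ f (n + 3) - 3 * f (n + 2) + 3 * f (n + 1) - f n)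
    (hhi : ∀ n, n + 3 < N → f (n + 3) - 3 * f (n + 2) + 3 * f (n + 1) - f n ≤ H * lam) :
    (Q : ℝ) ^ 2 * ‖∑ n ∈ range N, expChar (f n)‖ ^ 2
      ≤ (N + Q - 1) * (Q * N + 32 / (15 * √Real.pi) * (H * N * √lam) * ((Q : ℝ) ^ 2 * √Q)
          + 32 / (3 * √Real.pi * √lam) * (Q * √Q) + H * lam * N / 3 * (Q : ℝ) ^ 3
          + 3 * (Q : ℝ) ^ 2) := by
  have hQ' : (1 : ℝ) ≤ Q := by exact_mod_cast hQ
  refine (sq_norm_sum_range_expChar_le f N Q hQ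
    (fun r => 4 / √Real.pi * (H * N * √lam) * √r + 4 / (√Real.pi * √lam) * (1 / √r)
      + H * lam * N * r + 3) fun r hr hrQ => ?_).trans
    (mul_le_mul_of_nonneg_left ?_ (by linarith [(Nat.cast_nonneg N : (0 : ℝ) ≤ N)]))
  · have hr0 : (0 : ℝ) < r := by exact_mod_cast hr
    have hlo' : ∀ n, n + 2 < N - r →
        r * lam ≤ (f (n + 2 + r) - f (n + 2)) - 2 * (f (n + 1 + r) - f (n + 1))
          + (f (n + r) - f n) := fun n hn => by
      have := add_mul_le_of_step (g := fun k => f (k + 2) - 2 * f (k + 1) + f k) (lam := lam)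
        (i := n) (j := n + r) (by omega) fun k hk hk' => by
          have := hlo k (by omega)
          linarith
      push_cast at this
      rw [show n + r + 2 = n + 2 + r by ring, show n + r + 1 = n + 1 + r by ring] at this
      linarith
    have hhi' : ∀ n, n + 2 < N - r →
        (f (n + 2 + r) - f (n + 2)) - 2 * (f (n + 1 + r) - f (n + 1))
          + (f (n + r) - f n) ≤ H * (r * lam) := fun n hn => by
      have := le_add_mul_of_step (g := fun k => f (k + 2) - 2 * f (k + 1) + f k) (lam := H * lam)
        (i := n) (j := n + r) (by omega) fun k hk hk' => by
          have := hhi k (by omega)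
          linarith
      push_cast at this
      rw [show n + r + 2 = n + 2 + r by ring, show n + r + 1 = n + 1 + r by ring] at this
      linarith
    have h := norm_sum_range_expChar_le_of_diff_two (fun n => f (n + r) - f n) (N - r)
      (mul_pos hr0 hlam) hH hlo' hhi'
    rw [← mul_four_div_sqrt_add hlam hr0]
    have h1 : ((N - r : ℕ) : ℝ) ≤ N := by exact_mod_cast Nat.sub_le N r
    refine h.trans ?_
    gcongr
  · have h1 := sum_sub_mul_sqrt_le Q
    have h2 := sum_sub_div_sqrt_le Q
    have h3 := sum_sub_mul_le Q
    have h4 := sum_sub_le Q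
    have c1 : 0 ≤ 4 / √Real.pi * (H * N * √lam) := by positivity
    have c2 : 0 ≤ 4 / (√Real.pi * √lam) := by positivity
    have c3 : 0 ≤ H * lam * N := by positivity
    have e : ∑ r ∈ Ico 1 Q, (Q - r : ℝ) * (4 / √Real.pi * (H * N * √lam) * √r
          + 4 / (√Real.pi * √lam) * (1 / √r) + H * lam * N * r + 3)
        = 4 / √Real.pi * (H * N * √lam) * ∑ r ∈ Ico 1 Q, (Q - r : ℝ) * √r
          + 4 / (√Real.pi * √lam) * ∑ r ∈ Ico 1 Q, (Q - r : ℝ) * (1 / √r)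
          + H * lam * N * ∑ r ∈ Ico 1 Q, (Q - r : ℝ) * r + 3 * ∑ r ∈ Ico 1 Q, (Q - r : ℝ) := by
      simp only [mul_sum, ← sum_add_distrib]
      exact sum_congr rfl fun r _ => by ring
    rw [e]
    have g1 := mul_le_mul_of_nonneg_left h1 c1
    have g2 := mul_le_mul_of_nonneg_left h2 c2
    have g3 := mul_le_mul_of_nonneg_left h3 c3
    have e1 : 32 / (15 * √Real.pi) * (H * N * √lam) * ((Q : ℝ) ^ 2 * √Q)
        = 2 * (4 / √Real.pi * (H * N * √lam) * (4 / 15 * ((Q : ℝ) ^ 2 * √Q))) := by ring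
    have e2 : 32 / (3 * √Real.pi * √lam) * (Q * √Q)
        = 2 * (4 / (√Real.pi * √lam) * (4 / 3 * (Q * √Q))) := by ring
    rw [e1, e2]
    linarith

lemma deltaBase_sq (η : ℝ) :
    deltaBase η ^ 2 = 1 / 2 + 1 / 2 * √(1 + 3 / 8 * Real.pi ^ ((1 : ℝ) / 2) * η ^ ((3 : ℝ) / 2)) :=
  Real.sq_sqrt (by positivity)

lemma one_le_deltaBase {η : ℝ} (hη : 0 < η) : 1 ≤ deltaBase η := by
  have h : 1 ≤ √(1 + 3 / 8 * Real.pi ^ ((1 : ℝ) / 2) * η ^ ((3 : ℝ) / 2)) := by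
    rw [Real.one_le_sqrt]
    have : 0 ≤ 3 / 8 * Real.pi ^ ((1 : ℝ) / 2) * η ^ ((3 : ℝ) / 2) := by positivity
    linarith
  rw [deltaBase, Real.one_le_sqrt]
  linarith

/-- So δ² is the positive root of x² = x + (3√π/32) η^(3/2). This is equivalent to η/B₃² = δ² - 1,
the relation for which δ is chosen. -/
lemma deltaBase_pow_four {η : ℝ} (hη : 0 < η) :
    (deltaBase η ^ 2) ^ 2 = deltaBase η ^ 2 + 3 * √Real.pi / 32 * (η * √η) := by
  have h1 : η ^ ((3 : ℝ) / 2) = η * √η := by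
    rw [show (3 : ℝ) / 2 = 1 + 1 / 2 by norm_num, Real.rpow_add hη, Real.rpow_one,
      Real.sqrt_eq_rpow]
  have h2 : √(1 + 3 / 8 * Real.pi ^ ((1 : ℝ) / 2) * η ^ ((3 : ℝ) / 2)) ^ 2
      = 1 + 3 / 8 * √Real.pi * (η * √η) := by
    rw [Real.sq_sqrt (by positivity), h1, Real.sqrt_eq_rpow Real.pi]
  rw [deltaBase_sq]
  linear_combination 1 / 4 * h2

lemma B₃_sq {η : ℝ} (hη : 0 < η) :
    B₃ η ^ 2 = 32 / (3 * √Real.pi) / √η * deltaBase η ^ 2 := by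
  have h : ∀ x : ℝ, 0 < x → (x ^ ((1 : ℝ) / 4)) ^ 2 = √x := fun x hx => by
    rw [← Real.rpow_natCast, ← Real.rpow_mul hx.le, Real.sqrt_eq_rpow]
    norm_num
  rw [B₃, mul_pow, div_pow, mul_pow, mul_pow, h _ Real.pi_pos, h _ hη,
    Real.sq_sqrt (by norm_num), Real.sq_sqrt (by norm_num)]
  ring

lemma B₃_pos {η : ℝ} (hη : 0 < η) : 0 < B₃ η := by
  have := one_le_deltaBase hη
  have := Real.pi_pos
  rw [B₃]
  positivity

lemma lambdaZero_pos {η h : ℝ} (hη : 0 < η) (hh : 0 < h) : 0 < lambdaZero η h := by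
  have := Real.pi_pos
  rw [lambdaZero]
  positivity

lemma lambdaZero_rpow {η h : ℝ} (hη : 0 < η) (hh : 0 < h) :
    lambdaZero η h ^ ((1 : ℝ) / 3) = (1 / η + 32 / (15 * √Real.pi) * √η * h)⁻¹ := by
  have hπ := Real.pi_pos
  have h1 : lambdaZero η h = (1 / η + 32 / (15 * √Real.pi) * √η * h)⁻¹ ^ (3 : ℕ) := by
    rw [lambdaZero, Real.sqrt_eq_rpow η, zpow_neg, inv_pow]
    congr 1
    norm_cast
    ring
  rw [h1, ← Real.rpow_natCast, ← Real.rpow_mul (by positivity)]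
  norm_num

lemma A₃_pos {η h : ℝ} (hη : 0 < η) (hh : 0 < h) : 0 < A₃ η h := by
  have := one_le_deltaBase hη
  have := lambdaZero_pos hη hh
  have := Real.pi_pos
  rw [A₃]
  refine mul_pos (Real.sqrt_pos.2 ?_) (by linarith)
  positivity

lemma A₃_sq {η h l : ℝ} (hη : 0 < η) (hh : 0 < h) (hl : l = lambdaZero η h ^ ((1 : ℝ) / 3)) :
    A₃ η h ^ 2 = (1 / (η * h) + 32 / (15 * √Real.pi) * √(η + l) + 1 / 3 * (η + l) * l)
      * deltaBase η ^ 2 := by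
  have := lambdaZero_pos hη hh
  have := Real.pi_pos
  rw [A₃, mul_pow, Real.sq_sqrt (by positivity), hl]

/-- The product of the constants of the third derivative test is bounded below. -/
lemma sq_mul_deltaBase_le {η h H : ℝ} (hη : 0 < η) (hh : 0 < h) (hH : 1 ≤ H) :
    7 * (deltaBase η ^ 2) ^ 2 ≤ A₃ η h ^ 2 * H * B₃ η ^ 2 := by
  have hπ := Real.pi_pos
  have hl := lambdaZero_pos hη hh
  set l := lambdaZero η h ^ ((1 : ℝ) / 3) with hl'
  have hlpos : 0 < l := Real.rpow_pos_of_pos hl _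
  rw [A₃_sq hη hh hl', B₃_sq hη]
  have h1 : 32 / (15 * √Real.pi) * √η
      ≤ 1 / (η * h) + 32 / (15 * √Real.pi) * √(η + l) + 1 / 3 * (η + l) * l := by
    have e1 : 0 ≤ 1 / (η * h) := by positivity
    have e2 : 0 ≤ 1 / 3 * (η + l) * l := by positivity
    have e3 : 32 / (15 * √Real.pi) * √η ≤ 32 / (15 * √Real.pi) * √(η + l) := by
      gcongr
      linarith
    linarith
  -- The product is 1024/(45π), slightly above 7; the powers of η cancel.
  have h2 : (7 : ℝ) ≤ 32 / (15 * √Real.pi) * √η * (32 / (3 * √Real.pi) / √η) := by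
    have e : 32 / (15 * √Real.pi) * √η * (32 / (3 * √Real.pi) / √η) = 1024 / (45 * Real.pi) := by
      have := Real.sq_sqrt hπ.le
      have : 0 < √Real.pi := Real.sqrt_pos.2 hπ
      have : 0 < √η := Real.sqrt_pos.2 hη
      field_simp
      rw [Real.sq_sqrt hπ.le]
      ring
    rw [e, le_div_iff₀ (by positivity)]
    linarith [Real.pi_lt_d2]
  generalize 1 / (η * h) + 32 / (15 * √Real.pi) * √(η + l) + 1 / 3 * (η + l) * l = P at h1 ⊢
  have h3 : 0 ≤ 32 / (15 * √Real.pi) * √η := by positivity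
  have h4 : 32 / (15 * √Real.pi) * √η * (32 / (3 * √Real.pi) / √η)
      ≤ P * H * (32 / (3 * √Real.pi) / √η) := by
    refine mul_le_mul_of_nonneg_right ?_ (by positivity)
    exact h1.trans (le_mul_of_one_le_right (h3.trans h1) hH)
  calc 7 * (deltaBase η ^ 2) ^ 2
      ≤ P * H * (32 / (3 * √Real.pi) / √η) * (deltaBase η ^ 2) ^ 2 := by
        gcongr
        exact h2.trans h4
    _ = _ := by ring

lemma sq_add_expand (a k n b : ℝ) {s : ℝ} (hs : s ≠ 0) :
    (a * k * (n * n) / s + b * n * s) ^ 2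
      = a ^ 2 * (k * k) * (n * n) ^ 2 / (s * s) + b ^ 2 * (n * n) * (s * s)
        + 2 * (a * k * b) * ((n * n) * n) := by
  field_simp
  ring

set_option maxHeartbeats 1000000 in
/-- The right side of the third derivative test majorizes the differencing bound. -/
lemma third_test_majorant {N Q w s η P H lam dl A B S : ℝ} (hN : 1 ≤ N) (hw : 0 < w)
    (hs : s = √w) (hη : 0 < η) (hH : 0 < H) (hlam : lam * w ^ 3 = 1) (hQ : η * w ≤ Q)
    (hQ' : Q ≤ η * w + 1)
    (hP : 1 / (η * H) + 32 / (15 * √Real.pi) * √(η + 1 / w) + 1 / 3 * (η + 1 / w) * (1 / w) ≤ P)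
    (hA : A ^ 2 = P * dl) (hB : B ^ 2 = 32 / (3 * √Real.pi) / √η * dl) (hA0 : 0 < A) (hB0 : 0 < B)
    (hdl : 1 + η * w / N ≤ dl) (hAB : 7 * dl ^ 2 ≤ A ^ 2 * H * B ^ 2)
    (hS : Q ^ 2 * S ^ 2 ≤ (N + Q - 1) * (Q * N + 32 / (15 * √Real.pi) * (H * N * √lam) * (Q ^ 2 * √Q)
          + 32 / (3 * √Real.pi * √lam) * (Q * √Q) + H * lam * N / 3 * Q ^ 3 + 3 * Q ^ 2)) :
    S ≤ A * √H * N / s + B * √N * s := by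
  have hπ := Real.pi_pos
  have hηw : 0 < η * w := by positivity
  have hQ0 : 0 < Q := by linarith
  have hs0 : 0 < s := by rw [hs]; exact Real.sqrt_pos.2 hw
  have hss : s * s = w := by rw [hs]; exact Real.mul_self_sqrt hw.le
  have hlam0 : 0 < lam := by
    by_contra hc
    nlinarith [pow_pos hw 3]
  have hsl : √lam = 1 / (w * s) := by
    rw [Real.sqrt_eq_iff_mul_self_eq hlam0.le (by positivity)]
    rw [show 1 / (w * s) * (1 / (w * s)) = 1 / (w ^ 2 * (s * s)) by field_simp, hss,
      eq_comm, div_eq_iff (by positivity)]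
    linear_combination -hlam
  have hlam' : lam = 1 / w ^ 3 := by
    rw [eq_div_iff (by positivity)]
    exact hlam
  have hdl0 : 0 < dl := by
    have : 0 ≤ η * w / N := by positivity
    linarith
  have hsQ : √Q ≤ s * √(η + 1 / w) := by
    rw [hs, ← Real.sqrt_mul hw.le]
    refine Real.sqrt_le_sqrt ?_
    rw [mul_add, mul_one_div_cancel hw.ne']
    linarith
  have hsQ' : s * √η ≤ √Q := by
    rw [hs, ← Real.sqrt_mul hw.le, mul_comm]
    exact Real.sqrt_le_sqrt hQ
  have hsη : 0 < √η := Real.sqrt_pos.2 hη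
  have hsQ0 : 0 < √Q := Real.sqrt_pos.2 hQ0
  have hQQ : √Q * √Q = Q := Real.mul_self_sqrt hQ0.le
  set c := 32 / (15 * √Real.pi) with hc
  set d := 32 / (3 * √Real.pi) with hd
  have hc0 : 0 < c := by positivity
  have hd0 : 0 < d := by positivity
  set G := N / Q + c * (H * N * √lam) * √Q + d / √lam / √Q + H * lam * N / 3 * Q + 3 with hG
  have hSG : S ^ 2 ≤ (N + Q - 1) * G := by
    have e : Q * N + c * (H * N * √lam) * (Q ^ 2 * √Q)
          + 32 / (3 * √Real.pi * √lam) * (Q * √Q) + H * lam * N / 3 * Q ^ 3 + 3 * Q ^ 2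
        = Q ^ 2 * G := by
      have e1 : 32 / (3 * √Real.pi * √lam) = d / √lam := by rw [hd]; field_simp
      have e2 : Q * √Q = Q ^ 2 * (1 / √Q) := by
        field_simp
        linear_combination hQQ
      rw [e1, e2, hG]
      field_simp
    rw [e] at hS
    have hQ2 : 0 < Q ^ 2 := by positivity
    have : Q ^ 2 * S ^ 2 ≤ Q ^ 2 * ((N + Q - 1) * G) := by linarith
    exact le_of_mul_le_mul_left this hQ2
  have hG1 : G ≤ N * H / w * P + d / √η * w + 3 := by
    have g1 : N / Q ≤ N * H / w * (1 / (η * H)) := by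
      rw [show N * H / w * (1 / (η * H)) = N / (η * w) by field_simp]
      gcongr
    have g2 : c * (H * N * √lam) * √Q ≤ N * H / w * (c * √(η + 1 / w)) := by
      rw [hsl]
      calc c * (H * N * (1 / (w * s))) * √Q
          ≤ c * (H * N * (1 / (w * s))) * (s * √(η + 1 / w)) := by gcongr
        _ = _ := by field_simp
    have g3 : d / √lam / √Q ≤ d / √η * w := by
      rw [hsl]
      calc d / (1 / (w * s)) / √Q ≤ d / (1 / (w * s)) / (s * √η) := by gcongr
        _ = _ := by field_simp
    have g4 : H * lam * N / 3 * Q ≤ N * H / w * (1 / 3 * (η + 1 / w) * (1 / w)) := by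
      calc H * lam * N / 3 * Q ≤ H * lam * N / 3 * (η * w + 1) := by gcongr
        _ = _ := by
          rw [hlam']
          field_simp
    have g5 : N * H / w * (1 / (η * H) + c * √(η + 1 / w) + 1 / 3 * (η + 1 / w) * (1 / w))
        ≤ N * H / w * P := by gcongr
    rw [hG]
    linarith
  have hG0 : 0 ≤ G := by positivity
  have hS2 : S ^ 2 ≤ N * dl * (N * H / w * P + d / √η * w + 3) := by
    refine hSG.trans ?_
    have : N + Q - 1 ≤ N * dl := by
      calc N + Q - 1 ≤ N + η * w := by linarith
        _ = N * (1 + η * w / N) := by field_simp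
        _ ≤ N * dl := by gcongr
    exact mul_le_mul this hG1 hG0 (by positivity)
  have hN0 : 0 < √N := Real.sqrt_pos.2 (by linarith)
  have hNN : √N * √N = N := Real.mul_self_sqrt (by linarith)
  have hN1 : 1 ≤ √N := Real.one_le_sqrt.2 hN
  have hHH : √H * √H = H := Real.mul_self_sqrt hH.le
  have hH0 : 0 < √H := Real.sqrt_pos.2 hH
  -- The cross term of the squared target absorbs the constant 3 in the bound for G: 9δ⁴ ≤ 4 · 7δ⁴.
  have hcross : 3 * dl ≤ 2 * (A * √H * B) := by
    refine le_of_sq_le_sq ?_ (by positivity)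
    have : (2 * (A * √H * B)) ^ 2 = 4 * (A ^ 2 * H * B ^ 2) := by
      linear_combination 4 * A ^ 2 * B ^ 2 * hHH
    rw [this]
    nlinarith [sq_nonneg dl]
  have hfin : S ^ 2 ≤ (A * √H * N / s + B * √N * s) ^ 2 := by
    have e : (A * √H * N / s + B * √N * s) ^ 2
        = A ^ 2 * H * N ^ 2 / w + B ^ 2 * N * w + 2 * (A * √H * B) * (N * √N) := by
      have e1 := sq_add_expand A √H √N B hs0.ne'
      rwa [hNN, hHH, hss] at e1
    have e2 : N * dl * (N * H / w * P + d / √η * w + 3)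
        = A ^ 2 * H * N ^ 2 / w + B ^ 2 * N * w + 3 * dl * N := by
      rw [hA, hB]
      ring
    rw [e]
    rw [e2] at hS2
    have : 3 * dl * N ≤ 2 * (A * √H * B) * (N * √N) :=
      mul_le_mul hcross (by nlinarith) (by linarith) (by positivity)
    linarith
  exact le_of_sq_le_sq hfin (by positivity)

/-- The third derivative test, for sequences. -/
theorem norm_sum_range_expChar_le_of_diff_three (f : ℕ → ℝ) (N : ℕ) {lam η h H : ℝ}
    (hlam : 0 < lam) (hη : 0 < η) (hh : 0 < h) (hhH : h ≤ H) (hH : 1 ≤ H)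
    (hlo : ∀ n, n + 3 < N → lam ≤ f (n + 3) - 3 * f (n + 2) + 3 * f (n + 1) - f n)
    (hhi : ∀ n, n + 3 < N → f (n + 3) - 3 * f (n + 2) + 3 * f (n + 1) - f n ≤ H * lam) :
    ‖∑ n ∈ range N, expChar (f n)‖
      ≤ A₃ η h * √H * N * lam ^ ((1 : ℝ) / 6) + B₃ η * √N * lam ^ (-((1 : ℝ) / 6)) := by
  have hπ := Real.pi_pos
  have hA0 := A₃_pos hη hh
  have hB0 := B₃_pos hη
  have hH0 : 0 < √H := Real.sqrt_pos.2 (by linarith)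
  have htriv := norm_sum_expChar_le_card f (range N)
  rw [card_range] at htriv
  rcases Nat.eq_zero_or_pos N with rfl | hN
  · simp
  have hN1 : (1 : ℝ) ≤ N := by exact_mod_cast hN
  set w := lam ^ (-((1 : ℝ) / 3)) with hw
  have hw0 : 0 < w := Real.rpow_pos_of_pos hlam _
  have hlamw : lam * w ^ 3 = 1 := by
    rw [hw, ← Real.rpow_natCast, ← Real.rpow_mul hlam.le]
    norm_num
    rw [Real.rpow_neg_one, mul_inv_cancel₀ hlam.ne']
  have hs1 : lam ^ (-((1 : ℝ) / 6)) = √w := by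
    rw [hw, Real.sqrt_eq_rpow, ← Real.rpow_mul hlam.le]
    norm_num
  have hs2 : lam ^ ((1 : ℝ) / 6) = 1 / √w := by
    rw [← hs1, Real.rpow_neg hlam.le, div_inv_eq_mul, one_mul]
  rw [hs1, hs2, mul_one_div]
  have hs0 : 0 < √w := Real.sqrt_pos.2 hw0
  have hss : √w * √w = w := Real.mul_self_sqrt hw0.le
  set l := lambdaZero η h ^ ((1 : ℝ) / 3) with hl
  have hl1 := lambdaZero_rpow hη hh
  rw [← hl] at hl1
  have hl0 : 0 < l := Real.rpow_pos_of_pos (lambdaZero_pos hη hh) _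
  have hδ := one_le_deltaBase hη
  have hδ2 : 1 ≤ deltaBase η ^ 2 := one_le_pow₀ hδ
  have hAsq := A₃_sq hη hh hl
  have hBsq := B₃_sq hη
  set c := 32 / (15 * √Real.pi) with hc
  have hc0 : 0 < c := by positivity
  -- If λ ≥ λ₀, the first term alone is at least N. Below λ₀, the quantity 1/w = λ^(1/3) may be
  -- replaced by λ₀^(1/3) in the constant A₃.
  rcases le_or_gt l (1 / w) with hcase | hcase
  · have h1 : 1 ≤ A₃ η h ^ 2 * H / w := by
      have e1 : (1 / η + c * √η * h) * l = 1 := by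
        rw [hl1]
        exact mul_inv_cancel₀ (by positivity)
      have e2 : 1 / η + c * √η * h
          ≤ (1 / (η * h) + c * √(η + l) + 1 / 3 * (η + l) * l) * h := by
        have : √η ≤ √(η + l) := Real.sqrt_le_sqrt (by linarith)
        have e3 : c * √η * h ≤ c * √(η + l) * h := by gcongr
        have e4 : 0 ≤ 1 / 3 * (η + l) * l * h := by positivity
        have e5 : 1 / (η * h) * h = 1 / η := by field_simp
        linarith
      have e3 : (1 / (η * h) + c * √(η + l) + 1 / 3 * (η + l) * l) * h ≤ A₃ η h ^ 2 * H := by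
        rw [hAsq]
        refine mul_le_mul ?_ hhH hh.le (by positivity)
        exact le_mul_of_one_le_right (by positivity) hδ2
      calc 1 = (1 / η + c * √η * h) * l := e1.symm
        _ ≤ A₃ η h ^ 2 * H * (1 / w) := mul_le_mul (e2.trans e3) hcase hl0.le (by positivity)
        _ = _ := by ring
    have h2 : 1 ≤ A₃ η h * √H / √w := by
      refine le_of_sq_le_sq ?_ (by positivity)
      rw [div_pow, mul_pow, Real.sq_sqrt (by linarith), Real.sq_sqrt hw0.le]
      simpa using h1
    have h3 : (N : ℝ) ≤ A₃ η h * √H * N / √w := by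
      calc (N : ℝ) = 1 * N := by ring
        _ ≤ A₃ η h * √H / √w * N := by gcongr
        _ = _ := by ring
    have h4 : 0 ≤ B₃ η * √N * √w := by positivity
    linarith
  -- If N ≤ B₃² w, the second term alone is at least N. Otherwise ηw/N < η/B₃² = δ² - 1, which is
  -- the bound needed for (N + Q - 1)/N.
  rcases le_or_gt (N : ℝ) (B₃ η ^ 2 * w) with hcase2 | hcase2
  · have h1 : √(N : ℝ) ≤ B₃ η * √w := by
      rw [Real.sqrt_le_left (by positivity), mul_pow, Real.sq_sqrt hw0.le]
      exact hcase2
    have h2 : (N : ℝ) ≤ B₃ η * √N * √w := by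
      calc (N : ℝ) = √(N : ℝ) * √(N : ℝ) := (Real.mul_self_sqrt (Nat.cast_nonneg N)).symm
        _ ≤ √(N : ℝ) * (B₃ η * √w) := by gcongr
        _ = _ := by ring
    have h4 : 0 ≤ A₃ η h * √H * N / √w := by positivity
    linarith
  have hQ : 1 ≤ ⌈η * w⌉₊ := Nat.one_le_ceil_iff.2 (by positivity)
  refine third_test_majorant (Q := ⌈η * w⌉₊) (η := η) (lam := lam) (dl := deltaBase η ^ 2)
    hN1 hw0 rfl hη (by linarith) hlamw (Nat.le_ceil _) (Nat.ceil_lt_add_one (by positivity)).le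
    ?_ hAsq hBsq hA0 hB0 ?_ (sq_mul_deltaBase_le hη hh hH)
    (sq_mul_sq_norm_le_of_diff_three f N _ hQ hlam (by linarith) hlo hhi)
  · have e1 : 1 / (η * H) ≤ 1 / (η * h) := by gcongr
    have e2 : c * √(η + 1 / w) ≤ c * √(η + l) := by gcongr
    have e3 : 1 / 3 * (η + 1 / w) * (1 / w) ≤ 1 / 3 * (η + l) * l := by gcongr
    linarith
  · have h1 := deltaBase_pow_four hη
    have hsη : 0 < √η := Real.sqrt_pos.2 hη
    have hηη : √η * √η = η := Real.mul_self_sqrt hη.le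
    have hπ0 : 0 < √Real.pi := Real.sqrt_pos.2 hπ
    have h2 : η * w / N ≤ η / B₃ η ^ 2 := by
      rw [div_le_div_iff₀ (by linarith) (by positivity)]
      nlinarith
    have h3 : η / B₃ η ^ 2 = deltaBase η ^ 2 - 1 := by
      rw [hBsq, div_eq_iff (by positivity)]
      have : (deltaBase η ^ 2 - 1) * (32 / (3 * √Real.pi) / √η * deltaBase η ^ 2)
          = 32 / (3 * √Real.pi) / √η * ((deltaBase η ^ 2) ^ 2 - deltaBase η ^ 2) := by ring
      rw [this, h1]
      field_simp
      ring
    linarith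

/-! ### The fourth derivative test for sequences. -/

/-- Differencing once and applying the third derivative test. -/
lemma sq_mul_sq_norm_le_of_diff_four (f : ℕ → ℝ) (N Q : ℕ) (hQ : 1 ≤ Q) {lam η h H : ℝ}
    (hlam : 0 < lam) (hη : 0 < η) (hh : 0 < h) (hhH : h ≤ H) (hH : 1 ≤ H)
    (hlo : ∀ n, n + 4 < N → lam ≤ f (n + 4) - 4 * f (n + 3) + 6 * f (n + 2) - 4 * f (n + 1) + f n)
    (hhi : ∀ n, n + 4 < N →
      f (n + 4) - 4 * f (n + 3) + 6 * f (n + 2) - 4 * f (n + 1) + f n ≤ H * lam) :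
    (Q : ℝ) ^ 2 * ‖∑ n ∈ range N, expChar (f n)‖ ^ 2
      ≤ (N + Q - 1) * (Q * N
          + 72 / 91 * (A₃ η h * √H * N) * ((Q : ℝ) ^ 2 * (Q * lam) ^ ((1 : ℝ) / 6))
          + 72 / 55 * (B₃ η * √N) * ((Q : ℝ) ^ 2 * (Q * lam) ^ (-((1 : ℝ) / 6)))) := by
  have hQ' : (1 : ℝ) ≤ Q := by exact_mod_cast hQ
  have hA0 := A₃_pos hη hh
  have hB0 := B₃_pos hη
  have hH0 : 0 < √H := Real.sqrt_pos.2 (by linarith)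
  refine (sq_norm_sum_range_expChar_le f N Q hQ
    (fun r => A₃ η h * √H * N * (r * lam) ^ ((1 : ℝ) / 6)
      + B₃ η * √N * (r * lam) ^ (-((1 : ℝ) / 6))) fun r hr hrQ => ?_).trans
    (mul_le_mul_of_nonneg_left ?_ (by linarith [(Nat.cast_nonneg N : (0 : ℝ) ≤ N)]))
  · have hr0 : (0 : ℝ) < r := by exact_mod_cast hr
    have hlo' : ∀ n, n + 3 < N - r →
        r * lam ≤ (f (n + 3 + r) - f (n + 3)) - 3 * (f (n + 2 + r) - f (n + 2))
          + 3 * (f (n + 1 + r) - f (n + 1)) - (f (n + r) - f n) := fun n hn => by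
      have := add_mul_le_of_step (g := fun k => f (k + 3) - 3 * f (k + 2) + 3 * f (k + 1) - f k)
        (lam := lam) (i := n) (j := n + r) (by omega) fun k hk hk' => by
          have := hlo k (by omega)
          linarith
      push_cast at this
      rw [show n + r + 3 = n + 3 + r by ring, show n + r + 2 = n + 2 + r by ring,
        show n + r + 1 = n + 1 + r by ring] at this
      linarith
    have hhi' : ∀ n, n + 3 < N - r →
        (f (n + 3 + r) - f (n + 3)) - 3 * (f (n + 2 + r) - f (n + 2))
          + 3 * (f (n + 1 + r) - f (n + 1)) - (f (n + r) - f n) ≤ H * (r * lam) := fun n hn => by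
      have := le_add_mul_of_step (g := fun k => f (k + 3) - 3 * f (k + 2) + 3 * f (k + 1) - f k)
        (lam := H * lam) (i := n) (j := n + r) (by omega) fun k hk hk' => by
          have := hhi k (by omega)
          linarith
      push_cast at this
      rw [show n + r + 3 = n + 3 + r by ring, show n + r + 2 = n + 2 + r by ring,
        show n + r + 1 = n + 1 + r by ring] at this
      linarith
    refine (norm_sum_range_expChar_le_of_diff_three (fun n => f (n + r) - f n) (N - r)
      (mul_pos hr0 hlam) hη hh hhH hH hlo' hhi').trans ?_
    have h1 : ((N - r : ℕ) : ℝ) ≤ N := by exact_mod_cast Nat.sub_le N r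
    gcongr
  -- The exponents ±1/6 give 72/91 = 2/((7/6)(13/6)) and 72/55 = 2/((5/6)(11/6)).
  · have h1 := sum_sub_mul_rpow_le_of_pos (p := 1 / 6) (by norm_num) (by norm_num) Q
    have h2 := sum_sub_mul_rpow_le_of_neg (p := -(1 / 6)) (by norm_num) (by norm_num) Q
    rw [Real.rpow_add (by linarith), Real.rpow_two] at h1 h2
    have c1 : 0 ≤ A₃ η h * √H * N * lam ^ ((1 : ℝ) / 6) := by positivity
    have c2 : 0 ≤ B₃ η * √N * lam ^ (-((1 : ℝ) / 6)) := by positivity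
    have e : ∑ r ∈ Ico 1 Q, (Q - r : ℝ) * (A₃ η h * √H * N * (r * lam) ^ ((1 : ℝ) / 6)
          + B₃ η * √N * (r * lam) ^ (-((1 : ℝ) / 6)))
        = A₃ η h * √H * N * lam ^ ((1 : ℝ) / 6)
            * ∑ r ∈ Ico 1 Q, (Q - r : ℝ) * (r : ℝ) ^ ((1 : ℝ) / 6)
          + B₃ η * √N * lam ^ (-((1 : ℝ) / 6))
            * ∑ r ∈ Ico 1 Q, (Q - r : ℝ) * (r : ℝ) ^ (-((1 : ℝ) / 6)) := by
      simp only [mul_sum, ← sum_add_distrib]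
      refine sum_congr rfl fun r _ => ?_
      rw [Real.mul_rpow (Nat.cast_nonneg r) hlam.le, Real.mul_rpow (Nat.cast_nonneg r) hlam.le]
      ring
    rw [e, Real.mul_rpow (Nat.cast_nonneg Q) hlam.le, Real.mul_rpow (Nat.cast_nonneg Q) hlam.le]
    have g1 := mul_le_mul_of_nonneg_left h1 c1
    have g2 := mul_le_mul_of_nonneg_left h2 c2
    refine le_trans (add_le_add le_rfl (mul_le_mul_of_nonneg_left (add_le_add g1 g2)
      (by norm_num))) (le_of_eq ?_)
    norm_num
    ring

/-- The right side of the fourth derivative test majorizes the differencing bound. -/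
lemma fourth_test_majorant {N Q w s lam H k m A B dl A' B' e S : ℝ} (hN : 1 ≤ N) (hw : 0 < w)
    (hs : 0 < s) (hsw : s ^ 2 = w) (hk : 0 < k) (hkH : k ^ 2 = √H) (hm : 0 < m) (hmN : m ^ 2 = √N)
    (hlam : 0 < lam) (hlamw : lam * w ^ 7 = 1) (hQ : w ≤ Q) (hQ1 : Q ≤ w + 1) (hQ2 : Q ≤ 2 * w)
    (hA : 0 < A) (hB : 0 < B) (hA' : 0 < A') (hB' : 0 < B') (he : e = (2 : ℝ) ^ ((1 : ℝ) / 6))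
    (hdl : 1 + w / N ≤ dl)
    (hAA : dl * (1 + 72 / 91 * e * √H * A) ≤ A' ^ 2 * √H) (hBB : B' ^ 2 = dl * (72 / 55 * B))
    (hS : Q ^ 2 * S ^ 2 ≤ (N + Q - 1) * (Q * N
          + 72 / 91 * (A * √H * N) * (Q ^ 2 * (Q * lam) ^ ((1 : ℝ) / 6))
          + 72 / 55 * (B * √N) * (Q ^ 2 * (Q * lam) ^ (-((1 : ℝ) / 6))))) :
    S ≤ A' * k * N / s + B' * m ^ 3 * s := by
  have hQ0 : 0 < Q := by linarith
  have hH0 : 0 < √H := by rw [← hkH]; positivity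
  have hN0 : 0 < √N := by rw [← hmN]; positivity
  have hNN : √N ^ 2 = N := Real.sq_sqrt (by linarith)
  have he0 : 0 < e := by rw [he]; positivity
  have hdl0 : 0 < dl := by
    have : 0 ≤ w / N := by positivity
    linarith
  have hlam' : lam = 1 / w ^ 7 := by
    rw [eq_div_iff (by positivity)]
    exact hlamw
  have hw6 : ∀ x : ℝ, 0 < x → (x ^ (6 : ℕ)) ^ ((1 : ℝ) / 6) = x := fun x hx => by
    rw [← Real.rpow_natCast, ← Real.rpow_mul hx.le]
    norm_num
  -- Since Q ≤ 2w, the loss is a factor 2^(1/6); it accounts for the exponent 19/12 in A₄, as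
  -- (2^(19/12))² = 8 · 2^(1/6).
  have h1 : (Q * lam) ^ ((1 : ℝ) / 6) ≤ e / w := by
    have : Q * lam ≤ 2 * (1 / w) ^ 6 := by
      calc Q * lam ≤ 2 * w * lam := by gcongr
        _ = _ := by
          rw [hlam']
          field_simp
    refine (Real.rpow_le_rpow (by positivity) this (by norm_num)).trans (le_of_eq ?_)
    rw [Real.mul_rpow (by norm_num) (by positivity), hw6 _ (by positivity), he]
    ring
  have h2 : (Q * lam) ^ (-((1 : ℝ) / 6)) ≤ w := by
    have : (1 / w) ^ 6 ≤ Q * lam := by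
      calc (1 / w) ^ 6 = w * lam := by
            rw [hlam']
            field_simp
        _ ≤ Q * lam := by gcongr
    refine (Real.rpow_le_rpow_of_nonpos (by positivity) this (by norm_num)).trans (le_of_eq ?_)
    rw [Real.rpow_neg (by positivity), hw6 _ (by positivity)]
    simp
  set G := N / Q + 72 / 91 * (A * √H * N) * (Q * lam) ^ ((1 : ℝ) / 6)
    + 72 / 55 * (B * √N) * (Q * lam) ^ (-((1 : ℝ) / 6)) with hG
  have hSG : S ^ 2 ≤ (N + Q - 1) * G := by
    have e1 : Q * N + 72 / 91 * (A * √H * N) * (Q ^ 2 * (Q * lam) ^ ((1 : ℝ) / 6))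
          + 72 / 55 * (B * √N) * (Q ^ 2 * (Q * lam) ^ (-((1 : ℝ) / 6))) = Q ^ 2 * G := by
      have : Q * N = Q ^ 2 * (N / Q) := by field_simp
      rw [hG, this]
      ring
    rw [e1] at hS
    have hQ2 : 0 < Q ^ 2 := by positivity
    have : Q ^ 2 * S ^ 2 ≤ Q ^ 2 * ((N + Q - 1) * G) := by linarith
    exact le_of_mul_le_mul_left this hQ2
  have hG0 : 0 ≤ G := by positivity
  have hG1 : G ≤ N / w * (1 + 72 / 91 * e * √H * A) + 72 / 55 * B * √N * w := by
    have g1 : N / Q ≤ N / w := by gcongr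
    have g2 : 72 / 91 * (A * √H * N) * (Q * lam) ^ ((1 : ℝ) / 6)
        ≤ 72 / 91 * (A * √H * N) * (e / w) := by gcongr
    have g3 : 72 / 55 * (B * √N) * (Q * lam) ^ (-((1 : ℝ) / 6)) ≤ 72 / 55 * (B * √N) * w := by
      gcongr
    have : N / w * (1 + 72 / 91 * e * √H * A)
        = N / w + 72 / 91 * (A * √H * N) * (e / w) := by ring
    rw [hG, this]
    linarith
  have hD : N + Q - 1 ≤ N * dl := by
    calc N + Q - 1 ≤ N + w := by linarith
      _ = N * (1 + w / N) := by field_simp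
      _ ≤ N * dl := by gcongr
  have hS2 : S ^ 2 ≤ N * dl * (N / w * (1 + 72 / 91 * e * √H * A) + 72 / 55 * B * √N * w) :=
    hSG.trans (mul_le_mul hD hG1 hG0 (by positivity))
  refine le_of_sq_le_sq ?_ (by positivity)
  have hX : (A' * k * N / s) ^ 2 = N ^ 2 / w * (A' ^ 2 * √H) := by
    rw [← hkH, ← hsw]
    ring
  have hY : (B' * m ^ 3 * s) ^ 2 = N * √N * w * B' ^ 2 := by
    have : m ^ 6 = N * √N := by
      calc m ^ 6 = (m ^ 2) ^ 2 * m ^ 2 := by ring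
        _ = N * √N := by rw [hmN, hNN]
    calc (B' * m ^ 3 * s) ^ 2 = m ^ 6 * s ^ 2 * B' ^ 2 := by ring
      _ = _ := by rw [this, hsw]
  have hXY : 0 ≤ A' * k * N / s * (B' * m ^ 3 * s) := by positivity
  have h3 : N ^ 2 / w * (dl * (1 + 72 / 91 * e * √H * A)) ≤ N ^ 2 / w * (A' ^ 2 * √H) := by
    gcongr
  have h4 : (A' * k * N / s + B' * m ^ 3 * s) ^ 2
      = N ^ 2 / w * (A' ^ 2 * √H) + N * √N * w * (dl * (72 / 55 * B))
        + 2 * (A' * k * N / s * (B' * m ^ 3 * s)) := by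
    rw [add_sq, hX, hY, hBB]
    ring
  have h5 : N * dl * (N / w * (1 + 72 / 91 * e * √H * A) + 72 / 55 * B * √N * w)
      = N ^ 2 / w * (dl * (1 + 72 / 91 * e * √H * A)) + N * √N * w * (dl * (72 / 55 * B)) := by
    ring
  rw [h4]
  rw [h5] at hS2
  linarith

lemma deltaStep_three_sq {η : ℝ} (hη : 0 < η) :
    deltaStep 3 η ^ 2 = 1 + 2 / √2337 * (9 * Real.pi / 1024 * η) ^ ((1 : ℝ) / 4) := by
  have hπ := Real.pi_pos
  have h : bigK 3 = 4 := by norm_num [bigK]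
  rw [deltaStep, h, Real.sq_sqrt (by positivity), Real.sqrt_eq_rpow]
  norm_num

lemma derivA_four {η h : ℝ} :
    derivA 4 η h = deltaStep 3 η *
      (h ^ (-((1 : ℝ) / 4)) + (2 : ℝ) ^ ((19 : ℝ) / 12) * 3 / √91 * √(A₃ η h)) := by
  have h4 : bigK (0 + 3) = 4 := by norm_num [bigK]
  rw [show (4 : ℕ) = 0 + 4 from rfl, derivA, h4, derivA, Real.sqrt_eq_rpow (A₃ η h)]
  norm_num

lemma derivB_four {η : ℝ} :
    derivB 4 η = deltaStep 3 η * ((2 : ℝ) ^ ((3 : ℝ) / 2) * 3 / √55) * √(B₃ η) := by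
  have h4 : bigK (0 + 3) = 4 := by norm_num [bigK]
  rw [show (4 : ℕ) = 0 + 4 from rfl, derivB, h4, derivB, Real.sqrt_eq_rpow (B₃ η)]
  norm_num

lemma one_le_deltaStep_three {η : ℝ} (hη : 0 < η) : 1 ≤ deltaStep 3 η := by
  have hπ := Real.pi_pos
  have h : 0 ≤ 2 / √2337 * (9 * Real.pi / 1024 * η) ^ ((1 : ℝ) / 4) := by positivity
  have h1 : 0 ≤ deltaStep 3 η := Real.sqrt_nonneg _
  refine le_of_sq_le_sq ?_ h1
  rw [deltaStep_three_sq hη]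
  linarith

lemma derivA_four_pos {η h : ℝ} (hη : 0 < η) (hh : 0 < h) : 0 < derivA 4 η h := by
  have := one_le_deltaStep_three hη
  have := A₃_pos hη hh
  rw [derivA_four]
  positivity

lemma derivB_four_pos {η : ℝ} (hη : 0 < η) : 0 < derivB 4 η := by
  have := one_le_deltaStep_three hη
  have := B₃_pos hη
  rw [derivB_four]
  positivity

lemma derivB_four_sq {η : ℝ} (hη : 0 < η) :
    derivB 4 η ^ 2 = deltaStep 3 η ^ 2 * (72 / 55 * B₃ η) := by
  have h : ((2 : ℝ) ^ ((3 : ℝ) / 2)) ^ 2 = 8 := by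
    rw [← Real.rpow_natCast, ← Real.rpow_mul (by norm_num)]
    norm_num
  rw [derivB_four, mul_pow, mul_pow, div_pow, mul_pow, h, Real.sq_sqrt (by norm_num),
    Real.sq_sqrt (B₃_pos hη).le]
  ring

/-- Squaring A₄ and dropping the nonnegative cross term leaves the coefficients 1 and 72/91 ·
2^(1/6); h^(-1/2) √H ≥ 1 handles the first one. -/
lemma le_derivA_four_sq {η h H : ℝ} (hη : 0 < η) (hh : 0 < h) (hhH : h ≤ H) :
    deltaStep 3 η ^ 2 * (1 + 72 / 91 * (2 : ℝ) ^ ((1 : ℝ) / 6) * √H * A₃ η h)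
      ≤ derivA 4 η h ^ 2 * √H := by
  have hA := A₃_pos hη hh
  have hH0 : 0 < √H := Real.sqrt_pos.2 (by linarith)
  have h1 : ((2 : ℝ) ^ ((19 : ℝ) / 12)) ^ 2 = 8 * (2 : ℝ) ^ ((1 : ℝ) / 6) := by
    rw [← Real.rpow_natCast, ← Real.rpow_mul (by norm_num),
      show (19 : ℝ) / 12 * (2 : ℕ) = (3 : ℕ) + 1 / 6 by norm_num, Real.rpow_add (by norm_num),
      Real.rpow_natCast]
    norm_num
  have h2 : (h ^ (-((1 : ℝ) / 4))) ^ 2 = 1 / √h := by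
    rw [← Real.rpow_natCast, ← Real.rpow_mul hh.le, Real.sqrt_eq_rpow, 
      one_div (_ ^ _), ← Real.rpow_neg_one (_ ^ _), ← Real.rpow_mul hh.le]
    norm_num
  have h3 : 1 ≤ 1 / √h * √H := by
    rw [one_div_mul_eq_div, one_le_div (Real.sqrt_pos.2 hh)]
    exact Real.sqrt_le_sqrt hhH
  rw [derivA_four, mul_pow, mul_assoc (deltaStep 3 η ^ 2)]
  refine mul_le_mul_of_nonneg_left ?_ (sq_nonneg _)
  rw [add_sq, mul_pow, div_pow, mul_pow, h1, h2, Real.sq_sqrt (by norm_num), Real.sq_sqrt hA.le]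
  have h4 : 0 ≤ 2 * h ^ (-((1 : ℝ) / 4)) * ((2 : ℝ) ^ ((19 : ℝ) / 12) * 3 / √91 * √(A₃ η h)) * √H := by
    positivity
  linarith

/-- The product is exactly `deltaBase η`. The power of η in `deltaStep 3 η` is thus comparable to
1/B₃, which is what bounding w/N requires. -/
lemma one_le_B₃_mul {η : ℝ} (hη : 0 < η) :
    1 ≤ B₃ η * (9 * Real.pi / 1024 * η) ^ ((1 : ℝ) / 4) := by
  have hπ := Real.pi_pos
  have hB := B₃_pos hη
  have h1 : ((9 * Real.pi / 1024 * η) ^ ((1 : ℝ) / 4)) ^ 4 = 9 * Real.pi / 1024 * η := by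
    rw [← Real.rpow_natCast, ← Real.rpow_mul (by positivity)]
    norm_num
  have h2 : B₃ η ^ 4 = 1024 / (9 * Real.pi * η) * (deltaBase η ^ 2) ^ 2 := by
    rw [show B₃ η ^ 4 = (B₃ η ^ 2) ^ 2 by ring, B₃_sq hη, mul_pow, div_pow, div_pow, mul_pow,
      Real.sq_sqrt hπ.le, Real.sq_sqrt hη.le]
    field_simp
    ring
  have h3 : (1 : ℝ) ≤ (deltaBase η ^ 2) ^ 2 :=
    one_le_pow₀ (one_le_pow₀ (one_le_deltaBase hη))
  refine (one_le_pow_iff_of_nonneg (by positivity) (show (4 : ℕ) ≠ 0 by norm_num)).1 ?_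
  rw [mul_pow, h1, h2]
  have : 1024 / (9 * Real.pi * η) * (deltaBase η ^ 2) ^ 2 * (9 * Real.pi / 1024 * η)
      = (deltaBase η ^ 2) ^ 2 := by field_simp
  rw [this]
  exact h3

set_option maxHeartbeats 1000000 in
/-- The fourth derivative test, from the differencing bounds for all step numbers `Q`. -/
lemma fourth_test_of_differencing {N : ℕ} {S lam H e dl A B A' B' g : ℝ} (hlam : 0 < lam)
    (hH : 1 ≤ H) (htriv : S ≤ N) (hA0 : 0 < A) (hB0 : 0 < B) (hA0' : 0 < A') (hB0' : 0 < B')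
    (hg0 : 0 < g) (he : e = (2 : ℝ) ^ ((1 : ℝ) / 6)) (hdl : dl = 1 + 2 / √2337 * g)
    (hAB : 5 / 2 ≤ A * √H * B) (hB1 : 1 ≤ B * g)
    (hAsq : dl * (1 + 72 / 91 * e * √H * A) ≤ A' ^ 2 * √H) (hBsq : B' ^ 2 = dl * (72 / 55 * B))
    (hdiff : ∀ Q : ℕ, 1 ≤ Q → (Q : ℝ) ^ 2 * S ^ 2 ≤ (N + Q - 1) * (Q * N
          + 72 / 91 * (A * √H * N) * ((Q : ℝ) ^ 2 * (Q * lam) ^ ((1 : ℝ) / 6))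
          + 72 / 55 * (B * √N) * ((Q : ℝ) ^ 2 * (Q * lam) ^ (-((1 : ℝ) / 6))))) (hN : 0 < N) :
    S ≤ A' * H ^ ((1 : ℝ) / 4) * N * lam ^ ((1 : ℝ) / 14)
        + B' * (N : ℝ) ^ ((3 : ℝ) / 4) * lam ^ (-((1 : ℝ) / 14)) := by
  have hH0 : 0 < √H := Real.sqrt_pos.2 (by linarith)
  have hN1 : (1 : ℝ) ≤ N := by exact_mod_cast hN
  have hNp : (0 : ℝ) < N := by linarith
  set w := lam ^ (-((1 : ℝ) / 7)) with hw
  have hw0 : 0 < w := Real.rpow_pos_of_pos hlam _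
  have hlamw : lam * w ^ 7 = 1 := by
    rw [hw, ← Real.rpow_natCast, ← Real.rpow_mul hlam.le]
    norm_num
    rw [Real.rpow_neg_one, mul_inv_cancel₀ hlam.ne']
  set s := lam ^ (-((1 : ℝ) / 14)) with hs
  have hs0 : 0 < s := Real.rpow_pos_of_pos hlam _
  have hsw : s ^ 2 = w := by
    rw [hw, hs, ← Real.rpow_natCast, ← Real.rpow_mul hlam.le]
    norm_num
  have hs2 : lam ^ ((1 : ℝ) / 14) = 1 / s := by
    rw [hs, Real.rpow_neg hlam.le, div_inv_eq_mul, one_mul]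
  set k := H ^ ((1 : ℝ) / 4) with hk
  have hk0 : 0 < k := Real.rpow_pos_of_pos (by linarith) _
  have hkH : k ^ 2 = √H := by
    rw [hk, Real.sqrt_eq_rpow, ← Real.rpow_natCast, ← Real.rpow_mul (by linarith)]
    norm_num
  set m := (N : ℝ) ^ ((1 : ℝ) / 4) with hm
  have hm0 : 0 < m := Real.rpow_pos_of_pos hNp _
  have hmN : m ^ 2 = √N := by
    rw [hm, Real.sqrt_eq_rpow, ← Real.rpow_natCast, ← Real.rpow_mul (by linarith)]
    norm_num
  have hm4 : m * m ^ 3 = N := by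
    rw [show m * m ^ 3 = (m ^ 2) ^ 2 by ring, hmN, Real.sq_sqrt hNp.le]
  have hm3 : (N : ℝ) ^ ((3 : ℝ) / 4) = m ^ 3 := by
    rw [hm, ← Real.rpow_natCast, ← Real.rpow_mul (by linarith)]
    norm_num
  rw [hs2, hm3, mul_one_div]
  have hX0 : 0 < A' * k * N / s := by positivity
  have hY0 : 0 < B' * m ^ 3 * s := by positivity
  have hδ2 : 1 ≤ dl := by
    have : 0 ≤ 2 / √2337 * g := by positivity
    linarith
  have he1 : 1 ≤ e := he ▸ Real.one_le_rpow (by norm_num) (by norm_num)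
  have hB2 : 72 / 55 * B ≤ B' ^ 2 := by
    rw [hBsq]
    exact le_mul_of_one_le_left (by positivity) hδ2
  have hA2 : 1 + 72 / 91 * e * √H * A ≤ (A' * k) ^ 2 := by
    rw [mul_pow, hkH]
    exact (le_mul_of_one_le_left (by positivity) hδ2).trans hAsq
  -- Three cases in which the claim is weaker than S ≤ N are removed. For w < 1 the first term
  -- suffices. For w ≥ 1, the ceiling Q satisfies Q ≤ 2w.
  rcases lt_or_ge w 1 with hcase | hcase
  · have h1 : s ≤ 1 := by nlinarith
    have h2 : 1 ≤ A' * k := by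
      have : 0 ≤ 72 / 91 * e * √H * A := by positivity
      exact (one_le_sq_iff₀ (by positivity)).1 (by linarith)
    have h3 : (N : ℝ) ≤ A' * k * N / s := by
      rw [le_div_iff₀ hs0]
      nlinarith
    linarith
  -- The product of the two terms does not involve λ, so AM–GM gives X + Y ≥ N once √N ≤ 16 · 5/2 =
  -- 40.
  rcases le_or_gt (N : ℝ) 1600 with hcase1 | hcase1
  · have h1 : (5 / 2 : ℝ) ≤ (A' * k * B') ^ 2 := by
      calc (5 / 2 : ℝ) ≤ 72 / 91 * (72 / 55) * (A * √H * B) := by linarith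
        _ = 72 / 91 * 1 * √H * A * (72 / 55 * B) := by ring
        _ ≤ 72 / 91 * e * √H * A * (72 / 55 * B) := by gcongr
        _ ≤ (A' * k) ^ 2 * B' ^ 2 := by
          refine mul_le_mul (by linarith) hB2 (by positivity) (by positivity)
        _ = _ := by ring
    have h2 : m ≤ 4 * (A' * k * B') := by
      refine le_of_sq_le_sq ?_ (by positivity)
      have : √(N : ℝ) ≤ 40 := by
        rw [Real.sqrt_le_left (by norm_num)]
        linarith
      rw [hmN, mul_pow]
      linarith
    have h3 : (N : ℝ) ≤ A' * k * N / s + B' * m ^ 3 * s := by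
      refine le_of_sq_le_sq ?_ (by positivity)
      have e1 : 4 * (A' * k * N / s) * (B' * m ^ 3 * s)
          = 4 * (A' * k * B') * (m ^ 3 * N) := by
        field_simp
      have e2 : m * (m ^ 3 * N) ≤ 4 * (A' * k * B') * (m ^ 3 * N) := by
        gcongr
      have e3 : m * (m ^ 3 * N) = (N : ℝ) ^ 2 := by rw [← mul_assoc, hm4, sq]
      nlinarith [sq_nonneg (A' * k * N / s - B' * m ^ 3 * s)]
    linarith
  rcases le_or_gt m (B' * s) with hcase2 | hcase2
  · have h3 : (N : ℝ) ≤ B' * m ^ 3 * s := by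
      calc (N : ℝ) = m * m ^ 3 := hm4.symm
        _ ≤ B' * s * m ^ 3 := by gcongr
        _ = _ := by ring
    linarith
  have hQ : 1 ≤ ⌈w⌉₊ := Nat.one_le_ceil_iff.2 hw0
  have hQ1 : (⌈w⌉₊ : ℝ) ≤ w + 1 := (Nat.ceil_lt_add_one hw0.le).le
  refine fourth_test_majorant (Q := ⌈w⌉₊) hN1 hw0 hs0 hsw hk0 hkH hm0 hmN hlam hlamw
    (Nat.le_ceil _) hQ1 (by linarith) hA0 hB0 hA0' hB0' he ?_ hAsq hBsq
    (hdiff _ hQ)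
  rw [hdl]
  have hN40 : 40 ≤ √(N : ℝ) := by
    rw [Real.le_sqrt' (by norm_num)]
    linarith
  have h1 : B' ^ 2 * w ≤ √N := by
    rw [← hmN, ← hsw, ← mul_pow]
    gcongr
  have h2 : 1 / √2337 ≥ (1 / 49 : ℝ) := by
    have : √2337 ≤ (49 : ℝ) := by
      rw [Real.sqrt_le_left (by norm_num)]
      norm_num
    gcongr
  -- Here B'² w ≤ √N, Bg ≥ 1 and √N ≥ 40 give w/N ≤ (55/72)g/40, which is below (2/49)g; and √2337 ≤
  -- 49.
  have h3 : w / N ≤ 2 / 49 * g := by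
    rw [div_le_iff₀ hNp]
    have e1 : 72 / 55 * B * w ≤ √N := le_trans (by gcongr) h1
    have e2 : w ≤ B * g * w := le_mul_of_one_le_left hw0.le hB1
    have e3 : B * g * w ≤ 55 / 72 * √N * g := by
      have := mul_le_mul_of_nonneg_right (show B * w ≤ 55 / 72 * √N by linarith) hg0.le
      linarith
    have e4 : √(N : ℝ) * 40 ≤ N := by
      have : √(N : ℝ) * √N = N := Real.mul_self_sqrt hNp.le
      nlinarith
    have e5 : 55 / 72 * √N * g ≤ 2 / 49 * g * N := by
      have : 55 / 72 * √(N : ℝ) ≤ 2 / 49 * N := by linarith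
      nlinarith
    linarith
  have h4 : 2 / 49 * g ≤ 2 / √2337 * g := by
    have : 2 / √2337 = 2 * (1 / √2337) := by ring
    rw [this]
    nlinarith
  linarith

/-- The fourth derivative test, for sequences. -/
theorem norm_sum_range_expChar_le_of_diff_four (f : ℕ → ℝ) (N : ℕ) {lam η h H : ℝ}
    (hlam : 0 < lam) (hη : 0 < η) (hh : 0 < h) (hhH : h ≤ H) (hH : 1 ≤ H)
    (hlo : ∀ n, n + 4 < N → lam ≤ f (n + 4) - 4 * f (n + 3) + 6 * f (n + 2) - 4 * f (n + 1) + f n)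
    (hhi : ∀ n, n + 4 < N →
      f (n + 4) - 4 * f (n + 3) + 6 * f (n + 2) - 4 * f (n + 1) + f n ≤ H * lam) :
    ‖∑ n ∈ range N, expChar (f n)‖
      ≤ derivA 4 η h * H ^ ((1 : ℝ) / 4) * N * lam ^ ((1 : ℝ) / 14)
        + derivB 4 η * (N : ℝ) ^ ((3 : ℝ) / 4) * lam ^ (-((1 : ℝ) / 14)) := by
  have hπ := Real.pi_pos
  have hA0 := A₃_pos hη hh
  have hB0 := B₃_pos hη
  have hA0' := derivA_four_pos hη hh
  have hB0' := derivB_four_pos hη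
  have hH0 : 0 < √H := Real.sqrt_pos.2 (by linarith)
  have htriv := norm_sum_expChar_le_card f (range N)
  rw [card_range] at htriv
  rcases Nat.eq_zero_or_pos N with rfl | hN
  · simp
  refine fourth_test_of_differencing hlam hH htriv hA0 hB0 hA0' hB0' (by positivity) rfl
    (deltaStep_three_sq hη) ?_ (one_le_B₃_mul hη) (le_derivA_four_sq hη hh hhH)
    (derivB_four_sq hη)
    (fun Q hQ => sq_mul_sq_norm_le_of_diff_four f N Q hQ hlam hη hh hhH hH hlo hhi) hN
  have h1 := sq_mul_deltaBase_le hη hh hH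
  have h2 : (1 : ℝ) ≤ (deltaBase η ^ 2) ^ 2 :=
    one_le_pow₀ (one_le_pow₀ (one_le_deltaBase hη))
  refine le_of_sq_le_sq ?_ (by positivity)
  rw [mul_pow, mul_pow, Real.sq_sqrt (by linarith)]
  linarith

/-! ### Differences of the logarithm and the estimate for one block. -/

/-- The fourth forward difference of the logarithm. -/
lemma exists_log_diff_four {x : ℝ} (hx : 0 < x) :
    ∃ ξ, x < ξ ∧ ξ < x + 1 ∧
      Real.log (x + 4) - 4 * Real.log (x + 3) + 6 * Real.log (x + 2) - 4 * Real.log (x + 1)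
        + Real.log x = -6 / (ξ * (ξ + 1) * (ξ + 2) * (ξ + 3)) := by
  -- The fourth difference of log is G(x+1) - G(x) for the third difference G, and G' is an explicit
  -- rational function; one mean value step suffices.
  set G : ℝ → ℝ := fun y =>
    Real.log (y + 3) - 3 * Real.log (y + 2) + 3 * Real.log (y + 1) - Real.log y with hG
  have hd : ∀ y, 0 < y → HasDerivAt G (-6 / (y * (y + 1) * (y + 2) * (y + 3))) y := fun y hy => by
    have h : ∀ c : ℝ, 0 ≤ c → HasDerivAt (fun y => Real.log (y + c)) (1 / (y + c)) y := fun c hc =>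
      ((hasDerivAt_id y).add_const c).log (by simp only [id]; positivity)
    have h0 : HasDerivAt (fun y => Real.log y) (1 / y) y := (hasDerivAt_id y).log hy.ne'
    refine ((((h 3 (by norm_num)).sub ((h 2 (by norm_num)).const_mul 3)).add
      ((h 1 (by norm_num)).const_mul 3)).sub h0).congr_deriv ?_
    field_simp
    ring
  obtain ⟨ξ, hξ, hξ'⟩ := exists_hasDerivAt_eq_slope G
    (fun y => -6 / (y * (y + 1) * (y + 2) * (y + 3))) (show x < x + 1 by linarith)
    (fun y hy => (hd y (lt_of_lt_of_le hx hy.1)).continuousAt.continuousWithinAt)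
    fun y hy => hd y (hx.trans hy.1)
  refine ⟨ξ, hξ.1, hξ.2, ?_⟩
  rw [add_sub_cancel_left, div_one] at hξ'
  rw [hξ', hG]
  simp only
  rw [show x + 1 + 3 = x + 4 by ring, show x + 1 + 2 = x + 3 by ring,
    show x + 1 + 1 = x + 2 by ring]
  ring

lemma log_diff_four_bounds {x : ℝ} (hx : 0 < x) :
    6 / (x + 4) ^ 4 ≤ -(Real.log (x + 4) - 4 * Real.log (x + 3) + 6 * Real.log (x + 2)
        - 4 * Real.log (x + 1) + Real.log x) ∧
      -(Real.log (x + 4) - 4 * Real.log (x + 3) + 6 * Real.log (x + 2)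
        - 4 * Real.log (x + 1) + Real.log x) ≤ 6 / x ^ 4 := by
  obtain ⟨ξ, h1, h2, h3⟩ := exists_log_diff_four hx
  have hξ : 0 < ξ := hx.trans h1
  rw [h3, neg_div, neg_neg]
  constructor
  · refine div_le_div_of_nonneg_left (by norm_num) (by positivity) ?_
    calc ξ * (ξ + 1) * (ξ + 2) * (ξ + 3)
        ≤ (x + 4) * (x + 4) * (x + 4) * (x + 4) := by
          gcongr ?_ * ?_ * ?_ * ?_ <;> linarith
      _ = (x + 4) ^ 4 := by ring
  · refine div_le_div_of_nonneg_left (by norm_num) (by positivity) ?_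
    calc x ^ 4 = x * x * x * x := by ring
      _ ≤ ξ * (ξ + 1) * (ξ + 2) * (ξ + 3) := by
          gcongr ?_ * ?_ * ?_ * ?_ <;> linarith

/-- The fourth derivative test for `∑ n ^ (-it)` over a block `(a, b]` with `b ≤ h a`. -/
lemma norm_sum_Ioc_expChar_log_le {a b : ℕ} (ha : 1 ≤ a) {t η h : ℝ} (ht : 0 < t) (hη : 0 < η)
    (hh : 1 < h) (hb : (b : ℝ) ≤ h * a) :
    ‖∑ n ∈ Ioc a b, expChar (-(t / (2 * Real.pi)) * Real.log n)‖
      ≤ derivA 4 η h * h * ((h - 1) * a) * (3 * t / (Real.pi * (h * a) ^ 4)) ^ ((1 : ℝ) / 14)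
        + derivB 4 η * ((h - 1) * a) ^ ((3 : ℝ) / 4)
          * (3 * t / (Real.pi * (h * a) ^ 4)) ^ (-((1 : ℝ) / 14)) := by
  have hπ := Real.pi_pos
  have hA := derivA_four_pos hη (show 0 < h by linarith)
  have hB := derivB_four_pos hη
  have ha' : (0 : ℝ) < a := by exact_mod_cast ha
  have hh1 : 0 < h - 1 := by linarith
  rcases Nat.lt_or_ge b a with hba | hba
  · rw [Ioc_eq_empty (by omega), sum_empty, norm_zero]
    positivity
  set lam := 3 * t / (Real.pi * (h * a) ^ 4) with hlam
  have hlam0 : 0 < lam := by positivity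
  set F : ℕ → ℝ := fun n => -(t / (2 * Real.pi)) * Real.log ((a + 1 + n : ℕ) : ℝ) with hF
  have hsum : ∑ n ∈ Ioc a b, expChar (-(t / (2 * Real.pi)) * Real.log n)
      = ∑ n ∈ range (b - a), expChar (F n) := by
    rw [show Ioc a b = Ico (a + 1) (b + 1) by ext; simp, sum_Ico_eq_sum_range,
      Nat.add_sub_add_right]
  have hN : ((b - a : ℕ) : ℝ) ≤ (h - 1) * a := by
    rw [Nat.cast_sub hba]
    linarith
  have hdiff : ∀ n, F (n + 4) - 4 * F (n + 3) + 6 * F (n + 2) - 4 * F (n + 1) + F n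
      = t / (2 * Real.pi) * -(Real.log ((a + 1 + n : ℝ) + 4) - 4 * Real.log ((a + 1 + n : ℝ) + 3)
        + 6 * Real.log ((a + 1 + n : ℝ) + 2) - 4 * Real.log ((a + 1 + n : ℝ) + 1)
        + Real.log (a + 1 + n : ℝ)) := fun n => by
    simp only [hF]
    push_cast
    simp only [← add_assoc]
    ring
  -- The arguments of the logarithm lie between a and b ≤ ha, so the fourth differences vary by a
  -- factor at most h⁴; hence H = h⁴, and H^(1/4) becomes the factor h.
  have hmain := norm_sum_range_expChar_le_of_diff_four F (b - a) (lam := lam) (η := η) (h := h)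
    (H := h ^ 4) hlam0 hη (by linarith) (le_self_pow₀ hh.le (by norm_num)) (one_le_pow₀ hh.le)
    (fun n hn => by
      rw [hdiff]
      have hx : (0 : ℝ) < a + 1 + n := by positivity
      have h1 := (log_diff_four_bounds hx).1
      have h2 : (a + 1 + n : ℝ) + 4 ≤ h * a := by
        refine le_trans ?_ hb
        exact_mod_cast (by omega : a + 1 + n + 4 ≤ b)
      calc lam = t / (2 * Real.pi) * (6 / (h * a) ^ 4) := by rw [hlam]; field_simp; norm_num
        _ ≤ t / (2 * Real.pi) * (6 / ((a + 1 + n : ℝ) + 4) ^ 4) := by gcongr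
        _ ≤ _ := by gcongr)
    (fun n hn => by
      rw [hdiff]
      have hx : (0 : ℝ) < a + 1 + n := by positivity
      have h1 := (log_diff_four_bounds hx).2
      have h2 : (a : ℝ) ≤ a + 1 + n := by
        have : (0 : ℝ) ≤ n := Nat.cast_nonneg n
        linarith
      calc _ ≤ t / (2 * Real.pi) * (6 / (a + 1 + n : ℝ) ^ 4) := by gcongr
        _ ≤ t / (2 * Real.pi) * (6 / (a : ℝ) ^ 4) := by gcongr
        _ = h ^ 4 * lam := by rw [hlam]; field_simp; norm_num)
  rw [hsum]
  have hh4 : (h ^ 4) ^ ((1 : ℝ) / 4) = h := by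
    rw [← Real.rpow_natCast, ← Real.rpow_mul (by linarith)]
    norm_num
  rw [hh4] at hmain
  refine hmain.trans ?_
  gcongr

/-- Abel summation with nonincreasing weights. -/
lemma norm_sum_Ioc_mul_le_of_antitone {c : ℕ → ℝ} {g : ℕ → ℂ} {a b : ℕ} (hab : a ≤ b) {M : ℝ}
    (hc : ∀ n, a ≤ n → c (n + 1) ≤ c n) (hc0 : ∀ n, a ≤ n → 0 ≤ c n)
    (hM : ∀ m, a ≤ m → m ≤ b → ‖∑ n ∈ Ioc a m, g n‖ ≤ M) :
    ‖∑ n ∈ Ioc a b, (c n : ℂ) * g n‖ ≤ c a * M := by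
  -- Subtracting the boundary term makes the induction close: each step adds (c m - c(m+1)) times a
  -- partial sum, and the weights telescope.
  have key : ∀ m, a ≤ m → m ≤ b →
      ‖∑ n ∈ Ioc a m, (c n : ℂ) * g n - c m * ∑ n ∈ Ioc a m, g n‖ ≤ (c a - c m) * M := by
    intro m ham
    induction m, ham using Nat.le_induction with
    | base => simp
    | succ m ham ih =>
      intro hm
      have h1 := ih (by omega)
      have h2 : ∑ n ∈ Ioc a (m + 1), (c n : ℂ) * g n - c (m + 1) * ∑ n ∈ Ioc a (m + 1), g n
          = (∑ n ∈ Ioc a m, (c n : ℂ) * g n - c m * ∑ n ∈ Ioc a m, g n)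
            + ((c m - c (m + 1) : ℝ) : ℂ) * ∑ n ∈ Ioc a m, g n := by
        rw [sum_Ioc_succ_top ham, sum_Ioc_succ_top ham]
        push_cast
        ring
      have h3 : 0 ≤ c m - c (m + 1) := by linarith [hc m ham]
      rw [h2]
      refine (norm_add_le _ _).trans ?_
      rw [norm_mul, Complex.norm_real, Real.norm_eq_abs, abs_of_nonneg h3]
      have h4 := mul_le_mul_of_nonneg_left (hM m ham (by omega)) h3
      linarith
  have h1 := key b hab le_rfl
  have h2 : ‖(c b : ℂ) * ∑ n ∈ Ioc a b, g n‖ ≤ c b * M := by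
    rw [norm_mul, Complex.norm_real, Real.norm_eq_abs, abs_of_nonneg (hc0 b hab)]
    exact mul_le_mul_of_nonneg_left (hM b hab le_rfl) (hc0 b hab)
  have h3 := norm_add_le (∑ n ∈ Ioc a b, (c n : ℂ) * g n - c b * ∑ n ∈ Ioc a b, g n)
    (c b * ∑ n ∈ Ioc a b, g n)
  rw [sub_add_cancel] at h3
  linarith

lemma natCast_cpow_eq {n : ℕ} (hn : 1 ≤ n) (t : ℝ) :
    (n : ℂ) ^ (-(1 / 2 : ℂ) - Complex.I * (t : ℂ))
      = (((n : ℝ) ^ (-(1 / 2) : ℝ) : ℝ) : ℂ) * expChar (-(t / (2 * Real.pi)) * Real.log n) := by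
  have hn' : (n : ℂ) ≠ 0 := by exact_mod_cast (by omega : n ≠ 0)
  have hn0 : (0 : ℝ) < n := by exact_mod_cast hn
  have hπ : (Real.pi : ℂ) ≠ 0 := by exact_mod_cast Real.pi_ne_zero
  rw [Complex.cpow_def_of_ne_zero hn', expChar, Real.rpow_def_of_pos hn0, Complex.ofReal_exp,
    ← Complex.exp_add, ← Complex.natCast_log]
  congr 1
  push_cast
  field_simp
  ring

/-- The bound for `∑ n ^ (-1/2-it)` over a block `(a, b]` with `b ≤ h a`. -/
lemma norm_sum_Ioc_cpow_le {a b : ℕ} (ha : 1 ≤ a) {t η h : ℝ} (ht : 0 < t) (hη : 0 < η)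
    (hh : 1 < h) (hb : (b : ℝ) ≤ h * a) :
    ‖∑ n ∈ Ioc a b, (n : ℂ) ^ (-(1 / 2 : ℂ) - Complex.I * (t : ℂ))‖
      ≤ (3 : ℝ) ^ ((1 : ℝ) / 14) / Real.pi ^ ((1 : ℝ) / 14) * derivA 4 η h * h ^ ((5 : ℝ) / 7)
            * (h - 1) * (t ^ ((1 : ℝ) / 14) * (a : ℝ) ^ ((3 : ℝ) / 14))
        + Real.pi ^ ((1 : ℝ) / 14) / (3 : ℝ) ^ ((1 : ℝ) / 14) * derivB 4 η * h ^ ((2 : ℝ) / 7)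
            * (h - 1) ^ ((3 : ℝ) / 4) * (t ^ (-((1 : ℝ) / 14)) * (a : ℝ) ^ ((15 : ℝ) / 28)) := by
  have hπ := Real.pi_pos
  have hA := derivA_four_pos hη (show 0 < h by linarith)
  have hB := derivB_four_pos hη
  have ha' : (0 : ℝ) < a := by exact_mod_cast ha
  have hh0 : 0 < h := by linarith
  have hh1 : 0 < h - 1 := by linarith
  rcases Nat.lt_or_ge b a with hba | hba
  · rw [Ioc_eq_empty (by omega), sum_empty, norm_zero]
    positivity
  have hcong : ∑ n ∈ Ioc a b, (n : ℂ) ^ (-(1 / 2 : ℂ) - Complex.I * (t : ℂ))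
      = ∑ n ∈ Ioc a b, (((n : ℝ) ^ (-(1 / 2) : ℝ) : ℝ) : ℂ)
        * expChar (-(t / (2 * Real.pi)) * Real.log n) := by
    refine sum_congr rfl fun n hn => ?_
    rw [mem_Ioc] at hn
    exact natCast_cpow_eq (by omega) t
  rw [hcong]
  refine (norm_sum_Ioc_mul_le_of_antitone (c := fun n => (n : ℝ) ^ (-(1 / 2) : ℝ)) hba
    (fun n hn => ?_) (fun n _ => by positivity) (fun m _ hm =>
      norm_sum_Ioc_expChar_log_le ha ht hη hh
        (le_trans (by exact_mod_cast hm) hb))).trans (le_of_eq ?_)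
  · have hn0 : (0 : ℝ) < n := by exact_mod_cast (by omega : 0 < n)
    exact Real.rpow_le_rpow_of_nonpos hn0 (by push_cast; linarith) (by norm_num)
  have e1 : (3 * t / (Real.pi * (h * a) ^ 4)) ^ ((1 : ℝ) / 14)
      = (3 : ℝ) ^ ((1 : ℝ) / 14) / Real.pi ^ ((1 : ℝ) / 14) * t ^ ((1 : ℝ) / 14)
        * (h ^ (-(2 / 7) : ℝ) * (a : ℝ) ^ (-(2 / 7) : ℝ)) := by
    rw [Real.div_rpow (by positivity) (by positivity), Real.mul_rpow (by norm_num) ht.le,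
      Real.mul_rpow hπ.le (by positivity), ← Real.rpow_natCast, ← Real.rpow_mul (by positivity),
      Real.rpow_neg hh0.le, Real.rpow_neg ha'.le, Real.mul_rpow hh0.le ha'.le]
    norm_num
    field_simp
  have e2 : (3 * t / (Real.pi * (h * a) ^ 4)) ^ (-((1 : ℝ) / 14))
      = Real.pi ^ ((1 : ℝ) / 14) / (3 : ℝ) ^ ((1 : ℝ) / 14) * t ^ (-((1 : ℝ) / 14))
        * (h ^ ((2 : ℝ) / 7) * (a : ℝ) ^ ((2 : ℝ) / 7)) := by
    rw [Real.rpow_neg (by positivity), e1, Real.rpow_neg hh0.le, Real.rpow_neg ha'.le,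
      Real.rpow_neg ht.le]
    field_simp
  have e3 : h ^ ((5 : ℝ) / 7) = h * h ^ (-(2 / 7) : ℝ) := by
    rw [← Real.rpow_one_add' hh0.le (by norm_num)]
    norm_num
  have e4 : (a : ℝ) ^ ((3 : ℝ) / 14)
      = (a : ℝ) ^ (-(1 / 2) : ℝ) * a * (a : ℝ) ^ (-(2 / 7) : ℝ) := by
    rw [← Real.rpow_add_one ha'.ne', ← Real.rpow_add ha']
    norm_num
  have e5 : (a : ℝ) ^ ((15 : ℝ) / 28)
      = (a : ℝ) ^ (-(1 / 2) : ℝ) * (a : ℝ) ^ ((3 : ℝ) / 4) * (a : ℝ) ^ ((2 : ℝ) / 7) := by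
    rw [← Real.rpow_add ha', ← Real.rpow_add ha']
    norm_num
  rw [e1, e2, e3, e4, e5, Real.mul_rpow hh1.le ha'.le]
  ring

/-! ### Cut points and the sum over blocks. -/

/-- Adding up bounds for the blocks between consecutive cut points. -/
lemma norm_sum_Ioc_le_sum_of_cuts {g : ℕ → ℂ} {c : ℕ → ℕ} {E : ℕ → ℝ} (hE : ∀ r, 0 ≤ E r) (m : ℕ)
    (hblock : ∀ r, r < m → ∀ b, b ≤ c r → ‖∑ n ∈ Ioc (c (r + 1)) b, g n‖ ≤ E (r + 1))
    (hc : ∀ r, c (r + 1) ≤ c r) {b : ℕ} (hb : b ≤ c 0) :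
    ‖∑ n ∈ Ioc (c m) b, g n‖ ≤ ∑ r ∈ range m, E (r + 1) := by
  induction m with
  | zero => simp [Ioc_eq_empty (show ¬c 0 < b by omega)]
  | succ m ih =>
    have h1 := ih fun r hr => hblock r (by omega)
    rw [sum_range_succ]
    rcases le_total b (c m) with h | h
    · have h2 := hblock m (by omega) b h
      have h3 : 0 ≤ ∑ r ∈ range m, E (r + 1) := sum_nonneg fun r _ => hE _
      linarith
    · rw [← sum_Ioc_consecutive _ (hc m) h]
      refine (norm_add_le _ _).trans ?_
      have h2 := hblock m (by omega) (c m) le_rfl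
      linarith

lemma sum_rpow_neg_mul {x p : ℝ} (hx : 1 < x) (hp : 0 < p) (m : ℕ) :
    ∑ r ∈ range m, (x ^ (-((r + 1 : ℕ) : ℤ))) ^ p = (1 - x ^ (-(p * m))) / (x ^ p - 1) := by
  have hx0 : 0 < x := by linarith
  have h1 : 1 < x ^ p := Real.one_lt_rpow hx hp
  have h2 : ∀ r : ℕ, (x ^ (-(r : ℤ))) ^ p = (x ^ p)⁻¹ ^ r := fun r => by
    rw [zpow_neg, zpow_natCast, Real.inv_rpow (by positivity), inv_pow, ← Real.rpow_natCast,
      ← Real.rpow_natCast, ← Real.rpow_mul hx0.le, ← Real.rpow_mul hx0.le, mul_comm]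
  have h3 : x ^ (-(p * m)) = (x ^ p)⁻¹ ^ m := by
    rw [Real.rpow_neg hx0.le, Real.rpow_mul hx0.le, Real.rpow_natCast, inv_pow]
  rw [sum_congr rfl fun r _ => h2 (r + 1), h3, eq_div_iff (by linarith)]
  clear h3
  generalize x ^ p = y at h1
  have hy : y ≠ 0 := by linarith
  induction m with
  | zero => simp
  | succ m ih =>
    rw [sum_range_succ, add_mul, ih, pow_succ]
    field_simp
    ring

/-- The ceiling in K is exactly what makes h₁^(-K) √(t/2π) ≤ θ₂ t^(7/17), with 3/34 = 1/2 - 7/17.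
Thus the blocks below a'_0 cover the whole sum. -/
lemma a_le_a'_zero {h₁ h₂ θ₂ t : ℝ} (ht : 0 < t) (hh₁ : 1 < h₁) (hθ₂ : 0 < θ₂) :
    a h₁ t (K h₁ θ₂ t) ≤ a' h₂ θ₂ t 0 := by
  have hπ := Real.pi_pos
  have hlog : 0 < Real.log h₁ := Real.log_pos hh₁
  have hs : 0 < √(2 * Real.pi) := Real.sqrt_pos.2 (by positivity)
  have h1 : (3 / 34 * Real.log t - Real.log (θ₂ * √(2 * Real.pi))) ≤ K h₁ θ₂ t * Real.log h₁ := by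
    rw [← div_le_iff₀ hlog]
    exact Int.le_ceil _
  refine Nat.floor_le_floor ?_
  have h2 : 0 < h₁ ^ (-K h₁ θ₂ t) := zpow_pos (by linarith) _
  rw [neg_zero, zpow_zero, one_mul, ← Real.log_le_log_iff (by positivity) (by positivity),
    Real.log_mul h2.ne' (by positivity), Real.log_mul (by positivity) (by positivity),
    Real.log_zpow, Real.log_rpow ht, Real.sqrt_div ht.le, Real.log_div (by positivity) hs.ne',
    Real.log_sqrt ht.le]
  rw [Real.log_mul hθ₂.ne' hs.ne'] at h1
  push_cast
  linarith

/-- A ceiling exceeds its argument by less than 1, so the lowest cut point overshoots θ₃ t^(27/82)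
by at most a factor h₂; here 115/1394 = 7/17 - 27/82. -/
lemma zpow_neg_mul_ge {h₂ θ₂ θ₃ t : ℝ} (ht : 0 < t) (hh₂ : 1 < h₂) (hθ₂ : 0 < θ₂) (hθ₃ : 0 < θ₃) :
    θ₃ / h₂ * t ^ ((27 : ℝ) / 82)
      ≤ h₂ ^ (-R h₂ θ₂ θ₃ t) * θ₂ * t ^ ((7 : ℝ) / 17) := by
  have hlog : 0 < Real.log h₂ := Real.log_pos hh₂
  have hh0 : 0 < h₂ := by linarith
  have h1 : (R h₂ θ₂ θ₃ t - 1) * Real.log h₂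
      ≤ 115 / 1394 * Real.log t - Real.log (θ₃ / θ₂) := by
    rw [← le_div_iff₀ hlog]
    have := Int.ceil_lt_add_one ((115 / 1394 * Real.log t - Real.log (θ₃ / θ₂)) / Real.log h₂)
    rw [R]
    linarith
  have h2 : 0 < h₂ ^ (-R h₂ θ₂ θ₃ t) := zpow_pos hh0 _
  rw [← Real.log_le_log_iff (by positivity) (by positivity),
    Real.log_mul (by positivity) (by positivity), Real.log_mul (by positivity) (by positivity),
    Real.log_mul h2.ne' hθ₂.ne', Real.log_zpow, Real.log_rpow ht, Real.log_rpow ht,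
    Real.log_div hθ₃.ne' hh0.ne']
  rw [Real.log_div hθ₃.ne' hθ₂.ne'] at h1
  push_cast
  linarith

lemma R_le_R {h₂ θ₂ θ₃ t t₁ : ℝ} (ht : 0 < t) (htt₁ : t ≤ t₁) (hh₂ : 1 < h₂) :
    R h₂ θ₂ θ₃ t ≤ R h₂ θ₂ θ₃ t₁ := by
  have hlog : 0 < Real.log h₂ := Real.log_pos hh₂
  have := Real.log_le_log ht htt₁
  refine Int.ceil_le_ceil ?_
  gcongr

lemma a'_antitone {h₂ θ₂ t : ℝ} (hh₂ : 1 < h₂) (ht : 0 < t) (hθ₂ : 0 < θ₂) {r s : ℤ} (hrs : r ≤ s) :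
    a' h₂ θ₂ t s ≤ a' h₂ θ₂ t r := by
  refine Nat.floor_le_floor ?_
  have : h₂ ^ (-s) ≤ h₂ ^ (-r) := zpow_le_zpow_right₀ hh₂.le (by omega)
  gcongr

lemma one_sub_rpow_nonneg {x y : ℝ} (hx : 1 < x) (hy : 0 ≤ y) : 0 ≤ 1 - x ^ (-y) := by
  have := Real.rpow_le_one_of_one_le_of_nonpos hx.le (neg_nonpos.2 hy)
  linarith

lemma le_h₃ {t₀ h₂ θ₃ : ℝ} (ht₀ : 0 < t₀) (hh₂ : 1 < h₂) (hθ₃ : 0 < θ₃)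
    (hh₃ : h₂ / θ₃ * t₀ ^ (-(27 : ℝ) / 82) < 1) : h₂ ≤ h₃ h₂ θ₃ t₀ := by
  have : 0 < h₂ / θ₃ * t₀ ^ (-(27 : ℝ) / 82) := by positivity
  rw [h₃, le_div_iff₀ (by linarith)]
  nlinarith

/-- Consecutive lower cut points have ratio at most `h₃`. -/
lemma a'_le_h₃_mul {t₀ t h₂ θ₂ θ₃ : ℝ} (ht₀ : 0 < t₀) (ht₀t : t₀ ≤ t) (hh₂ : 1 < h₂) (hθ₂ : 0 < θ₂)
    (hθ₃ : 0 < θ₃) (hh₃ : h₂ / θ₃ * t₀ ^ (-(27 : ℝ) / 82) < 1) {r : ℤ}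
    (hr : r + 1 ≤ R h₂ θ₂ θ₃ t) :
    1 ≤ a' h₂ θ₂ t (r + 1) ∧
      (a' h₂ θ₂ t r : ℝ) ≤ h₃ h₂ θ₃ t₀ * a' h₂ θ₂ t (r + 1) := by
  have ht : 0 < t := by linarith
  have hh0 : 0 < h₂ := by linarith
  set u := h₂ / θ₃ * t₀ ^ (-(27 : ℝ) / 82) with hu
  have hu0 : 0 < u := by positivity
  set X := h₂ ^ (-(r + 1)) * θ₂ * t ^ ((7 : ℝ) / 17) with hX
  have hXu : 1 ≤ u * X := by
    have h1 : h₂ ^ (-R h₂ θ₂ θ₃ t) * θ₂ * t ^ ((7 : ℝ) / 17) ≤ X := by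
      have : h₂ ^ (-R h₂ θ₂ θ₃ t) ≤ h₂ ^ (-(r + 1)) := zpow_le_zpow_right₀ hh₂.le (by omega)
      rw [hX]
      gcongr
    have h2 := (zpow_neg_mul_ge ht hh₂ hθ₂ hθ₃).trans h1
    have h3 : θ₃ / h₂ * t₀ ^ ((27 : ℝ) / 82) ≤ θ₃ / h₂ * t ^ ((27 : ℝ) / 82) := by gcongr
    have h4 : u * (θ₃ / h₂ * t₀ ^ ((27 : ℝ) / 82)) = 1 := by
      rw [hu, neg_div, Real.rpow_neg ht₀.le]
      field_simp
    calc 1 = u * (θ₃ / h₂ * t₀ ^ ((27 : ℝ) / 82)) := h4.symm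
      _ ≤ u * X := by gcongr; linarith
  have hX0 : 0 < X := by positivity
  have hX1 : 1 ≤ X := by nlinarith
  have hfl : X - 1 ≤ a' h₂ θ₂ t (r + 1) := by
    have := Nat.lt_floor_add_one X
    have e : a' h₂ θ₂ t (r + 1) = ⌊X⌋₊ := rfl
    rw [e]
    linarith
  refine ⟨(Nat.one_le_floor_iff X).2 hX1, ?_⟩
  have hup : (a' h₂ θ₂ t r : ℝ) ≤ h₂ * X := by
    refine (Nat.floor_le (by positivity)).trans (le_of_eq ?_)
    rw [hX, neg_add, zpow_add₀ hh0.ne', zpow_neg_one]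
    field_simp
  -- Before taking floors the ratio is h₂. The floor costs at most 1, and uX ≥ 1 gives X - 1 ≥ (1 -
  -- u)X; hence the denominator 1 - u in h₃.
  have h1 : h₂ * X ≤ h₃ h₂ θ₃ t₀ * (X - 1) := by
    rw [h₃, ← hu, div_mul_eq_mul_div, le_div_iff₀ (by linarith)]
    nlinarith
  have h2 := le_h₃ ht₀ hh₂ hθ₃ hh₃
  exact hup.trans (h1.trans (mul_le_mul_of_nonneg_left hfl (by linarith)))

lemma mul_rpow_cut {h₂ θ₂ t p q : ℝ} (ht : 0 < t) (hh₂ : 1 < h₂) (hθ₂ : 0 < θ₂) (r : ℤ) :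
    t ^ q * (h₂ ^ (-r) * θ₂ * t ^ ((7 : ℝ) / 17)) ^ p
      = t ^ (q + 7 / 17 * p) * θ₂ ^ p * (h₂ ^ (-r)) ^ p := by
  have h0 : 0 < h₂ ^ (-r) := zpow_pos (by linarith) _
  rw [Real.mul_rpow (by positivity) (by positivity), Real.mul_rpow h0.le hθ₂.le,
    ← Real.rpow_mul ht.le, Real.rpow_add ht]
  ring

end SubWeyl

theorem mainTheorem7 (t₀ t t₁ h₁ h₂ η₂ θ₂ θ₃ : ℝ)
    (ht₀ : 0 < t₀) (ht₀t : t₀ ≤ t) (htt₁ : t ≤ t₁)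
    (hh₁ : 1 < h₁) (hh₂ : 1 < h₂) (hη₂ : 0 < η₂) (hθ₂ : 0 < θ₂) (hθ₃ : 0 < θ₃)
    (hh₃ : h₂ / θ₃ * t₀ ^ (-(27 : ℝ) / 82) < 1)
    (hR : 0 ≤ SubWeyl.R h₂ θ₂ θ₃ t₁) :
    ‖SubWeyl.S₂ h₁ h₂ θ₂ θ₃ t‖ ≤
      SubWeyl.D₃ t₀ t₁ h₂ η₂ θ₂ θ₃ * t ^ ((19 : ℝ) / 119)
        + SubWeyl.D₄ t₀ t₁ h₂ η₂ θ₂ θ₃ * t ^ ((71 : ℝ) / 476) := by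
  open SubWeyl Finset in
  have ht : 0 < t := by linarith
  have hπ := Real.pi_pos
  have hh3 := le_h₃ ht₀ hh₂ hθ₃ hh₃
  set h := h₃ h₂ θ₃ t₀ with hh
  have hh1 : 0 < h - 1 := by linarith
  have hh0 : 0 < h := by linarith
  have hA := derivA_four_pos hη₂ hh0
  have hB := derivB_four_pos hη₂
  have hR1 : (0 : ℝ) ≤ R h₂ θ₂ θ₃ t₁ := by exact_mod_cast hR
  set C₁ := (3 : ℝ) ^ ((1 : ℝ) / 14) / Real.pi ^ ((1 : ℝ) / 14) * derivA 4 η₂ h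
    * h ^ ((5 : ℝ) / 7) * (h - 1) with hC₁
  set C₂ := Real.pi ^ ((1 : ℝ) / 14) / (3 : ℝ) ^ ((1 : ℝ) / 14) * derivB 4 η₂
    * h ^ ((2 : ℝ) / 7) * (h - 1) ^ ((3 : ℝ) / 4) with hC₂
  have hC₁0 : 0 < C₁ := by positivity
  have hC₂0 : 0 < C₂ := by positivity
  have hD₃ : D₃ t₀ t₁ h₂ η₂ θ₂ θ₃ = C₁ * θ₂ ^ ((3 : ℝ) / 14)
      * ((1 - h₂ ^ (-((3 : ℝ) / 14 * R h₂ θ₂ θ₃ t₁))) / (h₂ ^ ((3 : ℝ) / 14) - 1)) := by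
    rw [D₃, ← hh, hC₁, show -(3 * (R h₂ θ₂ θ₃ t₁ : ℝ)) / 14
      = -((3 : ℝ) / 14 * R h₂ θ₂ θ₃ t₁) by ring]
  have hD₄ : D₄ t₀ t₁ h₂ η₂ θ₂ θ₃ = C₂ * θ₂ ^ ((15 : ℝ) / 28)
      * ((1 - h₂ ^ (-((15 : ℝ) / 28 * R h₂ θ₂ θ₃ t₁))) / (h₂ ^ ((15 : ℝ) / 28) - 1)) := by
    rw [D₄, ← hh, hC₂, show -(15 * (R h₂ θ₂ θ₃ t₁ : ℝ)) / 28
      = -((15 : ℝ) / 28 * R h₂ θ₂ θ₃ t₁) by ring]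
  have hd₁ : 0 < h₂ ^ ((3 : ℝ) / 14) - 1 := by
    linarith [Real.one_lt_rpow hh₂ (show (0 : ℝ) < 3 / 14 by norm_num)]
  have hd₂ : 0 < h₂ ^ ((15 : ℝ) / 28) - 1 := by
    linarith [Real.one_lt_rpow hh₂ (show (0 : ℝ) < 15 / 28 by norm_num)]
  rw [hD₃, hD₄, S₂]
  -- If R(t) ≤ 0 then a_K ≤ a'_0 ≤ a'_R and the sum is empty; R(t₁) ≥ 0 makes the right side
  -- nonnegative.
  rcases le_or_gt (R h₂ θ₂ θ₃ t) 0 with hRt | hRt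
  · have h1 := a_le_a'_zero (h₂ := h₂) ht hh₁ hθ₂
    have h2 := a'_antitone hh₂ ht hθ₂ hRt
    rw [Ioc_eq_empty (by omega), sum_empty, norm_zero]
    have n₁ := one_sub_rpow_nonneg hh₂ (y := (3 : ℝ) / 14 * R h₂ θ₂ θ₃ t₁) (by positivity)
    have n₂ := one_sub_rpow_nonneg hh₂ (y := (15 : ℝ) / 28 * R h₂ θ₂ θ₃ t₁) (by positivity)
    positivity
  obtain ⟨m, hm⟩ : ∃ m : ℕ, R h₂ θ₂ θ₃ t = m := ⟨(R h₂ θ₂ θ₃ t).toNat, by omega⟩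
  have hmR : (m : ℝ) ≤ R h₂ θ₂ θ₃ t₁ := by
    have := R_le_R (θ₂ := θ₂) (θ₃ := θ₃) ht htt₁ hh₂
    rw [hm] at this
    exact_mod_cast this
  have hsum := norm_sum_Ioc_le_sum_of_cuts
    (g := fun n => (n : ℂ) ^ (-(1 / 2 : ℂ) - Complex.I * (t : ℂ)))
    (c := fun r => a' h₂ θ₂ t r)
    (E := fun r => C₁ * θ₂ ^ ((3 : ℝ) / 14) * t ^ ((19 : ℝ) / 119)
        * (h₂ ^ (-(r : ℤ))) ^ ((3 : ℝ) / 14)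
      + C₂ * θ₂ ^ ((15 : ℝ) / 28) * t ^ ((71 : ℝ) / 476) * (h₂ ^ (-(r : ℤ))) ^ ((15 : ℝ) / 28))
    (fun r => by
      have : 0 < h₂ := by linarith
      positivity) m
    (fun r hr b hb => by
      obtain ⟨h1, h2⟩ := a'_le_h₃_mul (r := r) ht₀ ht₀t hh₂ hθ₂ hθ₃ hh₃ (by rw [hm]; omega)
      have hX := Nat.floor_le (a := h₂ ^ (-((r : ℤ) + 1)) * θ₂ * t ^ ((7 : ℝ) / 17)) (by
        have : 0 < h₂ := by linarith
        positivity)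
      refine (norm_sum_Ioc_cpow_le (η := η₂) (h := h) (by exact_mod_cast h1) ht hη₂ (by linarith)
        ?_).trans ?_
      · refine le_trans (by exact_mod_cast hb) (h2.trans (le_of_eq ?_))
        push_cast
        rfl
      · rw [← hC₁, ← hC₂]
        push_cast
        have k₁ : t ^ ((1 : ℝ) / 14) * (a' h₂ θ₂ t (r + 1) : ℝ) ^ ((3 : ℝ) / 14)
            ≤ t ^ ((1 : ℝ) / 14)
              * (h₂ ^ (-((r : ℤ) + 1)) * θ₂ * t ^ ((7 : ℝ) / 17)) ^ ((3 : ℝ) / 14) := by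
          gcongr
          exact hX
        have k₂ : t ^ (-((1 : ℝ) / 14)) * (a' h₂ θ₂ t (r + 1) : ℝ) ^ ((15 : ℝ) / 28)
            ≤ t ^ (-((1 : ℝ) / 14))
              * (h₂ ^ (-((r : ℤ) + 1)) * θ₂ * t ^ ((7 : ℝ) / 17)) ^ ((15 : ℝ) / 28) := by
          gcongr
          exact hX
        rw [mul_rpow_cut ht hh₂ hθ₂] at k₁ k₂
        rw [show (1 : ℝ) / 14 + 7 / 17 * (3 / 14) = 19 / 119 by norm_num] at k₁
        rw [show -((1 : ℝ) / 14) + 7 / 17 * (15 / 28) = 71 / 476 by norm_num] at k₂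
        have j₁ := mul_le_mul_of_nonneg_left k₁ hC₁0.le
        have j₂ := mul_le_mul_of_nonneg_left k₂ hC₂0.le
        linarith)
    (fun r => a'_antitone hh₂ ht hθ₂ (by push_cast; omega))
    (b := a h₁ t (K h₁ θ₂ t)) (by simpa using a_le_a'_zero (h₂ := h₂) ht hh₁ hθ₂)
  rw [hm]
  refine hsum.trans ?_
  rw [sum_add_distrib, ← mul_sum, ← mul_sum, sum_rpow_neg_mul hh₂ (by norm_num),
    sum_rpow_neg_mul hh₂ (by norm_num)]
  -- The geometric sums have R(t) terms and increase with their number, so R(t) may be replaced by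
  -- R(t₁).
  have q₁ : (1 - h₂ ^ (-((3 : ℝ) / 14 * m))) / (h₂ ^ ((3 : ℝ) / 14) - 1)
      ≤ (1 - h₂ ^ (-((3 : ℝ) / 14 * R h₂ θ₂ θ₃ t₁))) / (h₂ ^ ((3 : ℝ) / 14) - 1) := by
    gcongr
    exact hh₂.le
  have q₂ : (1 - h₂ ^ (-((15 : ℝ) / 28 * m))) / (h₂ ^ ((15 : ℝ) / 28) - 1)
      ≤ (1 - h₂ ^ (-((15 : ℝ) / 28 * R h₂ θ₂ θ₃ t₁))) / (h₂ ^ ((15 : ℝ) / 28) - 1) := by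
    gcongr
    exact hh₂.le
  have p₁ := mul_le_mul_of_nonneg_left q₁
    (show 0 ≤ C₁ * θ₂ ^ ((3 : ℝ) / 14) * t ^ ((19 : ℝ) / 119) by positivity)
  have p₂ := mul_le_mul_of_nonneg_left q₂
    (show 0 ≤ C₂ * θ₂ ^ ((15 : ℝ) / 28) * t ^ ((71 : ℝ) / 476) by positivity)
  linarith

end
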